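/- Let $\eta,\lambda,\mu\in\mathbb C$ and $n\ge 1$. **20V model with DWBC2.** Consider the nodes $(i,j)$, $1\le i,j\le n$, of the triangular lattice: each node has the six incident edges West, Northwest, North (by which paths arrive) and East, Southeast, South (by which paths leave), an edge being horizontal, vertical, or a second diagonal $(i,j+1)\to(i+1,j)$. A configuration is a set of occupied edges such that at each node as many incoming as outgoing edges are occupied (ice rule), all the edges of the left and bottom boundaries except the upper left and the lower right diagonal ones are occupied, and all the other boundary edges are unoccupied. Its weight is the product over the nodes of the following node weights. An empty node and a node with all six edges occupied have weight $\omega_0$. A node with exactly one incoming and one outgoing occupied edge has weight $$\omega_6\ (W\to E),\quad \omega_5\ (W\to SE,\ NW\to E),\quad \omega_4\ (W\to S,\ N\to E),\quad \omega_3\ (NW\to SE),\quad \omega_2\ (NW\to S,\ N\to SE),\quad \omega_1\ (N\to S),$$ and a node with two incoming and two outgoing occupied edges has the weight of the complementary node (occupied and unoccupied edges exchanged). Here $$\begin{aligned} \omega_0&=\sin(\lambda+\eta)\sin\tfrac{\lambda+3\eta+\mu}{2}\sin\tfrac{\lambda+3\eta-\mu}{2},& \omega_1&=\sin(\lambda-\eta)\sin\tfrac{\lambda-\eta+\mu}{2}\sin\tfrac{\lambda+3\eta-\mu}{2},\\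 \omega_2&=\sin(2\eta)\sin(\lambda-\eta)\sin\tfrac{\lambda+3\eta-\mu}{2},& \omega_3&=\sin(2\eta)^3+\sin(\lambda+\eta)\sin\tfrac{\lambda-\eta+\mu}{2}\sin\tfrac{\lambda-\eta-\mu}{2},\\ \omega_4&=\sin(2\eta)\sin\tfrac{\lambda+3\eta+\mu}{2}\sin\tfrac{\lambda+3\eta-\mu}{2},& \omega_5&=\sin(2\eta)\sin(\lambda-\eta)\sin\tfrac{\lambda+3\eta+\mu}{2},\\ \omega_6&=\sin(\lambda-\eta)\sin\tfrac{\lambda+3\eta+\mu}{2}\sin\tfrac{\lambda-\eta-\mu}{2}.&& \end{aligned}$$ At each node the $k$-th occupied incoming edge from the top (order N, NW, W) is continued by the $k$-th occupied outgoing edge from the top (order E, SE, S); this decomposes a configuration into osculating paths. The uppermost path is the one that starts with the edge $(0,n)\to(1,n)$. It hits the right boundary, i.e. the line of abscissa $n$, at the first node $(n,L)$ of this line that it visits, and its step just before is horizontal or diagonal. Let $Z^{-}_{n;L}$ and $Z^{\diagdown}_{n;L}$ be the sums of the weights of the configurations for which the hitting point is $(n,L)$ and the step before it is horizontal, respectively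 diagonal, and set $$Z^{-}_n(\tau)=\sum_{L=1}^n Z^{-}_{n;L}\,\tau^{L-1},\qquad Z^{\diagdown}_n(\tau)=\sum_{L=1}^n Z^{\diagdown}_{n;L}\,\tau^{L-1}.$$ **6V model with DWBC.** In the same way, without diagonal edges: the horizontal edges of the left boundary and the vertical edges of the bottom boundary are occupied, the other boundary edges are unoccupied, and the ice rule holds at each node. The weight of a node is $a=\sin(\lambda+\eta)$ if it is empty or full, $b=\sin(\lambda-\eta)$ if exactly its two horizontal or its two vertical edges are occupied, and $c=\sin(2\eta)$ in the two remaining cases. Let $Z^{6V}_{n;L}$ be the sum of the weights of the configurations whose uppermost path hits the right boundary at $(n,L)$, and $Z^{6V}_n(\sigma)=\sum_{L=1}^n Z^{6V}_{n;L}\,\sigma^{L-1}$. **Theorem.** Let $q=e^{i\eta}$, $z=e^{i(\eta+\lambda)}$, $w=e^{-i(\eta+\lambda)}$, $t=e^{i\mu}$, $t^{1/3}=e^{i\mu/3}$, $\nu=1/(2i\,t^{1/3})$, $a_2=\nu(qz-q^{-1}t)$, $a_3=\nu(qt-q^{-1}w)$. Let $\sigma\in\mathbb C$ be such that $$D(\sigma)=\sigma\sin(\lambda-\eta)\sin\tfrac{\lambda-\eta-\mu}{2}-\sin(\lambda+\eta)\sin\tfrac{\lambda-5\eta-\mu}{2}\neq0,$$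 and assume $\sin\tfrac{\lambda-\eta+\mu}{2}\neq0$ (this is automatic for real angles with $0<\eta<\lambda<\pi-\eta$ and $\eta-\lambda<\mu<\lambda-\eta$). Then $$Z^{-}_n(\tau)+g(\sigma)\,Z^{\diagdown}_n(\tau)=\Big(\frac{a_2a_3}{t^{1/3}}\Big)^{n^2}Z^{6V}_n(\sigma),$$ where $$\tau=\sigma\,\frac{\sigma\sin(\lambda-\eta)\sin\frac{\lambda+3\eta-\mu}{2}-\sin(\lambda+\eta)\sin\frac{\lambda-\eta-\mu}{2}}{D(\sigma)}\cdot\frac{\sin\frac{\lambda+3\eta+\mu}{2}}{\sin\frac{\lambda-\eta+\mu}{2}},\qquad g(\sigma)=\frac{\sigma\sin(2\eta)\sin\frac{\lambda+3\eta+\mu}{2}}{D(\sigma)}.$$ -/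

import Mathlib

namespace TwentyVertex

/-- The three kinds of steps of an osculating path: horizontal `(1, 0)`, diagonal `(1, -1)`
and vertical `(0, -1)`. -/
inductive Step
  | hor
  | diag
  | vert
  deriving DecidableEq

/-- The local environment of a node: which of its six incident edges carry a path step.
`inc hor`, `inc diag`, `inc vert` are the edges to the West, Northwest and North of the node (by
which paths arrive); `out hor`, `out diag`, `out vert` are the edges to the East, Southeast and
South (by which paths leave). In terms of arrows, an edge carries a path step when it is oriented
from North, Northwest or West to East, Southeast or South. -/
structure Vertex where
  inc : Step → Bool
  out : Step → Bool

/-- The ice rule: as many ingoing as outgoing arrows at the node. An ingoing arrow is an occupied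
edge of `inc` or an unoccupied edge of `out`, so the rule says that as many path steps arrive at
the node as leave it. -/
def Vertex.Ice (u : Vertex) : Prop :=
  (u.inc .hor).toNat + (u.inc .diag).toNat + (u.inc .vert).toNat
    = (u.out .hor).toNat + (u.out .diag).toNat + (u.out .vert).toNat

/-- The number of occupied incoming edges above the incoming edge `s`
(from top to bottom: North, Northwest, West). -/
def Vertex.incAbove (u : Vertex) : Step → ℕ
  | .vert => 0
  | .diag => (u.inc .vert).toNat
  | .hor => (u.inc .vert).toNat + (u.inc .diag).toNat

/-- The number of occupied outgoing edges above the outgoing edge `t`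
(from top to bottom: East, Southeast, South). -/
def Vertex.outAbove (u : Vertex) : Step → ℕ
  | .hor => 0
  | .diag => (u.out .hor).toNat
  | .vert => (u.out .hor).toNat + (u.out .diag).toNat

/-- The path that arrives by the incoming edge `s` leaves by the outgoing edge `t`. The steps at a
node are concatenated in the unique non-crossing way: the `k`-th occupied incoming edge from the
top is continued by the `k`-th occupied outgoing edge from the top. -/
def Vertex.Linked (u : Vertex) (s t : Step) : Prop :=
  u.inc s = true ∧ u.out t = true ∧ u.incAbove s = u.outAbove t

/-- An assignment of path steps (`true` = occupied) to the edges of the `n × n` portion of the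
triangular lattice. The node `(x, y) : Fin n × Fin n` has coordinates `(x + 1, y + 1)`, the first
one growing to the right and the second one upwards. With these coordinates,
* `h i y` is the horizontal edge from `(i, y + 1)` to `(i + 1, y + 1)`;
* `v x j` is the vertical edge from `(x + 1, j + 1)` to `(x + 1, j)`;
* `d i j` is the diagonal edge from `(i, j + 1)` to `(i + 1, j)`.
The indices `d 0 0` and `d n n` do not correspond to edges (they touch no node). -/
@[ext]
structure EdgeConfig (n : ℕ) where
  h : Fin (n + 1) → Fin n → Bool
  v : Fin n → Fin (n + 1) → Bool
  d : Fin (n + 1) → Fin (n + 1) → Bool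

namespace EdgeConfig

variable {n : ℕ}

/-- An edge configuration is just a triple of functions. -/
def equivProd (n : ℕ) : EdgeConfig n ≃
    (Fin (n + 1) → Fin n → Bool) × (Fin n → Fin (n + 1) → Bool) ×
      (Fin (n + 1) → Fin (n + 1) → Bool) where
  toFun c := (c.h, c.v, c.d)
  invFun p := ⟨p.1, p.2.1, p.2.2⟩
  left_inv _ := rfl
  right_inv _ := rfl

instance instFintype (n : ℕ) : Fintype (EdgeConfig n) :=
  Fintype.ofEquiv _ (equivProd n).symm

/-- The environment of the node `(x, y)`. -/
def vertex (c : EdgeConfig n) (x y : Fin n) : Vertex where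
  inc
    | .hor => c.h x.castSucc y
    | .diag => c.d x.castSucc y.succ
    | .vert => c.v x y.succ
  out
    | .hor => c.h x.succ y
    | .diag => c.d x.succ y.castSucc
    | .vert => c.v x y.castSucc

/-- The boundary conditions of the horizontal and vertical edges: occupied on the left and bottom
boundaries, unoccupied on the right and top boundaries. In terms of arrows: horizontal boundary
edges point towards the square, vertical ones away from it. -/
structure SquareDWBC (c : EdgeConfig n) : Prop where
  left : ∀ y, c.h 0 y = true
  right : ∀ y, c.h (Fin.last n) y = false
  bottom : ∀ x, c.v x 0 = true
  top : ∀ x, c.v x (Fin.last n) = false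

/-- A configuration of the 20V model with domain wall boundary conditions DWBC2: the ice rule holds
at every node, all left and bottom boundary edges are occupied except the upper left and the lower
right diagonal ones, and all the other boundary edges are unoccupied. The two indices of `d` that
are not edges get the value `false`. -/
structure IsTwentyV (c : EdgeConfig n) : Prop where
  ice : ∀ x y, (c.vertex x y).Ice
  square : c.SquareDWBC
  left_diag : ∀ j, j ≠ 0 → j ≠ Fin.last n → c.d 0 j = true
  bottom_diag : ∀ i, i ≠ 0 → i ≠ Fin.last n → c.d i 0 = true
  right_diag : ∀ j, c.d (Fin.last n) j = false
  top_diag : ∀ i, c.d i (Fin.last n) = false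
  corner : c.d 0 0 = false

/-- A configuration of the 6V model with domain wall boundary conditions. The square lattice has no
diagonal edges, so no diagonal is occupied. -/
structure IsSixV (c : EdgeConfig n) : Prop where
  ice : ∀ x y, (c.vertex x y).Ice
  square : c.SquareDWBC
  no_diag : ∀ i j, c.d i j = false

end EdgeConfig

/-- The step `t` leads from the node `(x, y)` to the node `(x', y')`. -/
def Step.Leads {n : ℕ} (t : Step) (x y x' y' : Fin n) : Prop :=
  match t with
  | .hor => x'.val = x.val + 1 ∧ y' = y
  | .diag => x'.val = x.val + 1 ∧ y'.val + 1 = y.val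
  | .vert => x' = x ∧ y'.val + 1 = y.val

/-- `c.UppermostEnters x y s`: the uppermost path, which starts with the highest horizontal edge of
the left boundary and is continued at every node by `Vertex.Linked`, arrives at the node `(x, y)`
by a step `s`. -/
inductive EdgeConfig.UppermostEnters {n : ℕ} (c : EdgeConfig n) : Fin n → Fin n → Step → Prop
  | start (x y : Fin n) : x.val = 0 → y.val + 1 = n → c.h x.castSucc y = true →
      UppermostEnters c x y .hor
  | next (x y : Fin n) (s t : Step) (x' y' : Fin n) : UppermostEnters c x y s →
      (c.vertex x y).Linked s t → t.Leads x y x' y' → UppermostEnters c x' y' t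

/-- The uppermost path hits the line of the last column at the node of height `y` by a step `s`.
The node where a path hits the line is the first one on it, that is, the one that it does not enter
by a vertical step. -/
def EdgeConfig.HitsRight {n : ℕ} (c : EdgeConfig n) (y : Fin n) (s : Step) : Prop :=
  s ≠ .vert ∧ ∃ x : Fin n, x.val + 1 = n ∧ c.UppermostEnters x y s

/-- The weight of a node of the 20V model with weights `ω 0, …, ω 6`. The six arguments tell
whether the edges West, Northwest, North | East, Southeast, South are occupied. -/
def weight20 (ω : Fin 7 → ℂ) : Bool → Bool → Bool → Bool → Bool → Bool → ℂ
  -- no path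
  | false, false, false, false, false, false => ω 0
  -- one path
  | true, false, false, true, false, false => ω 6
  | true, false, false, false, true, false => ω 5
  | true, false, false, false, false, true => ω 4
  | false, true, false, true, false, false => ω 5
  | false, true, false, false, true, false => ω 3
  | false, true, false, false, false, true => ω 2
  | false, false, true, true, false, false => ω 4
  | false, false, true, false, true, false => ω 2
  | false, false, true, false, false, true => ω 1
  -- two paths: the complements of the preceding nine
  | false, true, true, false, true, true => ω 6
  | false, true, true, true, false, true => ω 5
  | false, true, true, true, true, false => ω 4
  | true, false, true, false, true, true => ω 5
  | true, false, true, true, false, true => ω 3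
  | true, false, true, true, true, false => ω 2
  | true, true, false, false, true, true => ω 4
  | true, true, false, true, false, true => ω 2
  | true, true, false, true, true, false => ω 1
  -- three paths
  | true, true, true, true, true, true => ω 0
  -- the ice rule is violated
  | _, _, _, _, _, _ => 0

/-- The weight of a node of the 6V model with weights `a, b, c`. The four arguments tell whether
the edges West, North | East, South are occupied. -/
def weight6 (a b c : ℂ) : Bool → Bool → Bool → Bool → ℂ
  | false, false, false, false => a
  | true, true, true, true => a
  | true, false, true, false => b
  | false, true, false, true => b
  | true, false, false, true => c
  | false, true, true, false => c
  | _, _, _, _ => 0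

def Vertex.weight20 (ω : Fin 7 → ℂ) (u : Vertex) : ℂ :=
  TwentyVertex.weight20 ω (u.inc .hor) (u.inc .diag) (u.inc .vert)
    (u.out .hor) (u.out .diag) (u.out .vert)

def Vertex.weight6 (a b c : ℂ) (u : Vertex) : ℂ :=
  TwentyVertex.weight6 a b c (u.inc .hor) (u.inc .vert) (u.out .hor) (u.out .vert)

section Weights

variable (η lam μ : ℂ)

/-- The weights `ω₀, …, ω₆` of the 20V model. -/
noncomputable def omega : Fin 7 → ℂ :=
  open Complex in
  ![sin (lam + η) * sin ((lam + 3 * η + μ) / 2) * sin ((lam + 3 * η - μ) / 2),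
    sin (lam - η) * sin ((lam - η + μ) / 2) * sin ((lam + 3 * η - μ) / 2),
    sin (2 * η) * sin (lam - η) * sin ((lam + 3 * η - μ) / 2),
    sin (2 * η) ^ 3 + sin (lam + η) * sin ((lam - η + μ) / 2) * sin ((lam - η - μ) / 2),
    sin (2 * η) * sin ((lam + 3 * η + μ) / 2) * sin ((lam + 3 * η - μ) / 2),
    sin (2 * η) * sin (lam - η) * sin ((lam + 3 * η + μ) / 2),
    sin (lam - η) * sin ((lam + 3 * η + μ) / 2) * sin ((lam - η - μ) / 2)]

/-- The weight `a = sin (λ + η)` of the 6V model. -/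
noncomputable def a6 : ℂ := Complex.sin (lam + η)

/-- The weight `b = sin (λ - η)` of the 6V model. -/
noncomputable def b6 : ℂ := Complex.sin (lam - η)

/-- The weight `c = sin (2 η)` of the 6V model. -/
noncomputable def c6 : ℂ := Complex.sin (2 * η)

/-- `q = exp (i η)`. -/
noncomputable def qPar : ℂ := Complex.exp (Complex.I * η)

/-- The horizontal spectral parameter `z = exp (i (η + λ))`. -/
noncomputable def zPar : ℂ := Complex.exp (Complex.I * (η + lam))

/-- The vertical spectral parameter `w = exp (- i (η + λ))`. -/
noncomputable def wPar : ℂ := Complex.exp (-(Complex.I * (η + lam)))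

/-- The diagonal spectral parameter `t = exp (i μ)`. -/
noncomputable def tPar : ℂ := Complex.exp (Complex.I * μ)

/-- The cube root `t ^ (1 / 3) = exp (i μ / 3)`. -/
noncomputable def tCbrt : ℂ := Complex.exp (Complex.I * μ / 3)

/-- The normalization `ν = 1 / (2 i t ^ (1 / 3))`. -/
noncomputable def nuPar : ℂ := 1 / (2 * Complex.I * tCbrt μ)

/-- `a₂ = ν (q z - q⁻¹ t)`. -/
noncomputable def a2 : ℂ := nuPar μ * (qPar η * zPar η lam - (qPar η)⁻¹ * tPar μ)

/-- `a₃ = ν (q t - q⁻¹ w)`. -/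
noncomputable def a3 : ℂ := nuPar μ * (qPar η * tPar μ - (qPar η)⁻¹ * wPar η lam)

/-- The common denominator of `tau` and `gFun`. -/
noncomputable def den (σ : ℂ) : ℂ :=
  open Complex in
  σ * sin (lam - η) * sin ((lam - η - μ) / 2) - sin (lam + η) * sin ((lam - 5 * η - μ) / 2)

/-- `τ` as a function of `σ`. -/
noncomputable def tau (σ : ℂ) : ℂ :=
  open Complex in
  σ * ((σ * sin (lam - η) * sin ((lam + 3 * η - μ) / 2)
      - sin (lam + η) * sin ((lam - η - μ) / 2)) / den η lam μ σ)
    * (sin ((lam + 3 * η + μ) / 2) / sin ((lam - η + μ) / 2))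

/-- The function `g (σ)`. -/
noncomputable def gFun (σ : ℂ) : ℂ :=
  open Complex in
  σ * sin (2 * η) * sin ((lam + 3 * η + μ) / 2) / den η lam μ σ

end Weights

section PartitionFunctions

variable (n : ℕ) (η lam μ : ℂ)

open scoped Classical in
/-- The partition function of the 20V configurations with DWBC2 whose uppermost path hits the line
of the last column at the node of height `y` by a step `s`. -/
noncomputable def Z20At (s : Step) (y : Fin n) : ℂ :=
  ∑ c : EdgeConfig n with c.IsTwentyV ∧ c.HitsRight y s,
    ∏ x, ∏ y', (c.vertex x y').weight20 (omega η lam μ)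

/-- The refined partition function of the 20V model with DWBC2, restricted to the configurations
whose uppermost path hits the line of the last column by a step `s`. The index `y` is `L - 1`,
where `L = 1, …, n` is the height of the hitting point. -/
noncomputable def Z20 (s : Step) (τ : ℂ) : ℂ :=
  ∑ y : Fin n, Z20At n η lam μ s y * τ ^ (y : ℕ)

open scoped Classical in
/-- The partition function of the 6V configurations with DWBC whose uppermost path hits the line
of the last column at the node of height `y`. -/
noncomputable def Z6At (y : Fin n) : ℂ :=
  ∑ c : EdgeConfig n with c.IsSixV ∧ ∃ s, c.HitsRight y s,
    ∏ x, ∏ y', (c.vertex x y').weight6 (a6 η lam) (b6 η lam) (c6 η)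

/-- The refined partition function of the 6V model with DWBC. The index `y` is `L - 1`, where
`L = 1, …, n` is the height of the hitting point. -/
noncomputable def Z6 (σ : ℂ) : ℂ :=
  ∑ y : Fin n, Z6At n η lam y * σ ^ (y : ℕ)

end PartitionFunctions

end TwentyVertex

/-! The lattice is read from the lower left to the upper right as a product of operators acting on
the occupations of three families of lines (`sum_boundary_eq`). A 20V node is a point where three
lines meet. Its operator factorizes into three six-vertex crossings, with the diagonal on either
side of the crossing of the other two lines (`nodeOp_eq_below`, `nodeOp_eq_above`). The equality of
the two factorizations is the Yang-Baxter equation, by which a diagonal slides across a whole row of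
horizontal-vertical crossings.

Under DWBC2 the diagonals `0 < k < n` are occupied at both ends and the diagonals `n ≤ k < 2n` are
empty at both ends. The former are slid out to the lower left, where all other lines are occupied
(`lower20_apply`), the latter to the upper right, where all other lines are empty (`upper20_apply`).
Outside the square every crossing is frozen, with weight `a₂` on a horizontal and `a₃` on a vertical
line. A diagonal meets as many lines of each kind as it has nodes, so all `n²` nodes together give
`(a₂ a₃) ^ n²`. What remains is the 6V model.

For the refinement, the last column gets modified weights: `σ b` instead of `b` for its crossings
with horizontal lines, and new values of `b₃`, `c₃` for its crossings with diagonals. Paths never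
leave this column to the right, so the Yang-Baxter equation is needed there only for empty exits,
which costs two relations instead of three (`crossOp_below_eq_above`). They form a linear system for
the new `b₃`, `c₃`, whose solution yields `τ(σ)` and `g(σ)` (`compatible_sinWeights`). On the 20V
side the modification multiplies a node of the last column by `τ` if it is entered vertically and by
`g` if it is entered diagonally; on the 6V side it gives `σ` for each vertical entry. Exactly one
path enters that column, at the hitting point, so these factors reproduce the generating functions
(`prod_last_column`). -/

namespace TwentyVertex

/-! ### Local operators on the occupations of lines -/

open Function

/-- The lines of the triangular lattice. The diagonal `d k` carries the edges `d i j`, `i + j = k`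
and the nodes `(x, y)` with `x + y + 1 = k`. -/
inductive Line
  | h (y : ℕ)
  | v (x : ℕ)
  | d (k : ℕ)
  deriving DecidableEq

/-- An occupation of the lines cut by a staircase. -/
abbrev State := Line → Bool

/-- The operator of the crossing of the lines `i` and `j`, acting by pull-back on functions of the
state. -/
def crossOp (i j : Line) (M : Bool → Bool → Bool → Bool → ℂ) : Module.End ℂ (State → ℂ) where
  toFun φ s := ∑ p, ∑ q, M (s i) (s j) p q * φ (update (update s i p) j q)
  map_add' φ ψ := by
    funext s
    simp only [Pi.add_apply, mul_add, Finset.sum_add_distrib]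
  map_smul' r φ := by
    funext s
    simp only [Pi.smul_apply, smul_eq_mul, Finset.mul_sum, RingHom.id_apply]
    exact Finset.sum_congr rfl fun _ _ => Finset.sum_congr rfl fun _ _ => by ring

/-- The operator of a node where the lines `i`, `j` and `k` meet. -/
def nodeOp (i j k : Line) (M : Bool → Bool → Bool → Bool → Bool → Bool → ℂ) :
    Module.End ℂ (State → ℂ) where
  toFun φ s := ∑ p, ∑ q, ∑ r,
    M (s i) (s j) (s k) p q r * φ (update (update (update s i p) j q) k r)
  map_add' φ ψ := by
    funext s
    simp only [Pi.add_apply, mul_add, Finset.sum_add_distrib]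
  map_smul' r φ := by
    funext s
    simp only [Pi.smul_apply, smul_eq_mul, Finset.mul_sum, RingHom.id_apply]
    exact Finset.sum_congr rfl fun _ _ => Finset.sum_congr rfl fun _ _ =>
      Finset.sum_congr rfl fun _ _ => by ring

theorem crossOp_apply (i j : Line) (M : Bool → Bool → Bool → Bool → ℂ) (φ : State → ℂ)
    (s : State) : crossOp i j M φ s
      = ∑ p, ∑ q, M (s i) (s j) p q * φ (update (update s i p) j q) := rfl

theorem nodeOp_apply (i j k : Line) (M : Bool → Bool → Bool → Bool → Bool → Bool → ℂ)
    (φ : State → ℂ) (s : State) : nodeOp i j k M φ s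
      = ∑ p, ∑ q, ∑ r, M (s i) (s j) (s k) p q r
          * φ (update (update (update s i p) j q) k r) := rfl

/-- Crossings without a common line commute. -/
theorem crossOp_commute {i j k l : Line} (hik : i ≠ k) (hil : i ≠ l) (hjk : j ≠ k) (hjl : j ≠ l)
    (M M' : Bool → Bool → Bool → Bool → ℂ) : Commute (crossOp i j M) (crossOp k l M') := by
  refine LinearMap.ext fun φ => funext fun s => ?_
  have key : ∀ p q p' q' : Bool, update (update (update (update s i p) j q) k p') l q'
      = update (update (update (update s k p') l q') i p) j q := by
    intro p q p' q'
    rw [update_comm hjk, update_comm hik, update_comm hjl, update_comm hil]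
  simp only [Module.End.mul_apply, crossOp_apply, Fintype.sum_bool, key]
  simp only [update_of_ne hik, update_of_ne hil, update_of_ne hjk, update_of_ne hjl,
    update_of_ne hik.symm, update_of_ne hil.symm, update_of_ne hjk.symm, update_of_ne hjl.symm]
  ring

/-- The state `s` with the values of three lines replaced. -/
def State.set (s : State) (i j k : Line) (p q r : Bool) : State :=
  update (update (update s i p) j q) k r

/-- Once a state is written as `s.set`, the lemmas `crossOp_set_left`, `crossOp_set_mid` and
`crossOp_set_right` keep it in this form, so that operator identities on three lines become finite
sums over Booleans. -/
theorem State.set_self (s : State) (i j k : Line) : s.set i j k (s i) (s j) (s k) = s := by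
  unfold State.set
  simp only [update_eq_self]

theorem crossOp_set_left {i j k : Line} (hij : i ≠ j) (hik : i ≠ k) (hjk : j ≠ k)
    (φ : State → ℂ) (s : State) (M : Bool → Bool → Bool → Bool → ℂ) (p q r : Bool) :
    crossOp i j M φ (s.set i j k p q r) = ∑ p', ∑ q', M p q p' q' * φ (s.set i j k p' q' r) := by
  have e : ∀ p' q' : Bool, update (update (s.set i j k p q r) i p') j q' = s.set i j k p' q' r := by
    intro p' q'
    funext l
    simp only [State.set, update_apply]
    split_ifs <;> simp_all
  simp only [crossOp_apply, e]
  simp [State.set, hij, hik, hjk]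

theorem crossOp_set_mid {i j k : Line} (hij : i ≠ j) (hik : i ≠ k)
    (φ : State → ℂ) (s : State) (M : Bool → Bool → Bool → Bool → ℂ) (p q r : Bool) :
    crossOp i k M φ (s.set i j k p q r) = ∑ p', ∑ r', M p r p' r' * φ (s.set i j k p' q r') := by
  have e : ∀ p' r' : Bool, update (update (s.set i j k p q r) i p') k r' = s.set i j k p' q r' := by
    intro p' q'
    funext l
    simp only [State.set, update_apply]
    split_ifs <;> simp_all
  simp only [crossOp_apply, e]
  simp [State.set, hij, hik]

theorem crossOp_set_right {i j k : Line} (hjk : j ≠ k)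
    (φ : State → ℂ) (s : State) (M : Bool → Bool → Bool → Bool → ℂ) (p q r : Bool) :
    crossOp j k M φ (s.set i j k p q r) = ∑ q', ∑ r', M q r q' r' * φ (s.set i j k p q' r') := by
  have e : ∀ q' r' : Bool, update (update (s.set i j k p q r) j q') k r' = s.set i j k p q' r' := by
    intro p' q'
    funext l
    simp only [State.set, update_apply]
    split_ifs <;> simp_all
  simp only [crossOp_apply, e]
  simp [State.set, hjk]

/-- The weights of the crossing of a horizontal and a vertical line; the arguments tell whether
the edges West, South | East, North are occupied. -/
def horVert (a b c : ℂ) (W S E N : Bool) : ℂ := weight6 a b c W N E S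

/-- The weights of the crossing of a vertical and a diagonal line; the arguments tell whether
the edges South, Northwest | North, Southeast are occupied. -/
def vertDiag (a b c : ℂ) (S I N O : Bool) : ℂ := weight6 a b c I N O S

/-- The weights of a node; the arguments tell whether the edges
West, South, Northwest | East, North, Southeast are occupied. -/
def node20 (ω : Fin 7 → ℂ) (W S I E N O : Bool) : ℂ := weight20 ω W I N E O S

/-- The weights of the 20V model built from those of three crossings. -/
def triWeights (a b c a₂ b₂ a₃ b₃ : ℂ) : Fin 7 → ℂ :=
  ![a * a₃ * a₂, b * b₃ * a₂, c * b * a₂, c ^ 3 + a * b₃ * b₂, c * a₃ * a₂, c * b * a₃,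
    b * a₃ * b₂]

/-! ### Factorization of a node and the Yang-Baxter equation -/

section YangBaxter

variable {a b c a₂ b₂ a₃ b₃ : ℂ}

/-- Some entries agree as polynomials. In the others two internal configurations of the triangle
contribute, and one of the three relations, multiplied by `c`, collapses their sum to a monomial. -/
theorem sum_below_eq_weight (h₁ : b * a₂ = a * b₂ + c * b₃) (h₂ : a₂ * a₃ = b₂ * b₃ + c * a)
    (h₃ : b * a₃ = a * b₃ + c * b₂) (W S I E N O : Bool) :
    ∑ p, ∑ r, weight6 a₂ b₂ c W I p r * ∑ q, vertDiag a₃ b₃ c S r q O * horVert a b c p q E N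
      = node20 (triWeights a b c a₂ b₂ a₃ b₃) W S I E N O := by
  cases W <;> cases S <;> cases I <;> cases E <;> cases N <;> cases O <;>
    simp [weight6, horVert, vertDiag, node20, weight20, triWeights] <;>
    first
    | ring1
    | linear_combination c * h₁
    | linear_combination -c * h₁
    | linear_combination c * h₂
    | linear_combination -c * h₂
    | linear_combination c * h₃
    | linear_combination -c * h₃

theorem sum_above_eq_weight (h₁ : b * a₂ = a * b₂ + c * b₃) (h₂ : a₂ * a₃ = b₂ * b₃ + c * a)
    (h₃ : b * a₃ = a * b₃ + c * b₂) (W S I E N O : Bool) :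
    ∑ p, ∑ q, horVert a b c W S p q * ∑ r, vertDiag a₃ b₃ c q I N r * weight6 a₂ b₂ c p r E O
      = node20 (triWeights a b c a₂ b₂ a₃ b₃) W S I E N O := by
  cases W <;> cases S <;> cases I <;> cases E <;> cases N <;> cases O <;>
    simp [weight6, horVert, vertDiag, node20, weight20, triWeights] <;>
    first
    | ring1
    | linear_combination c * h₁
    | linear_combination -c * h₁
    | linear_combination c * h₂
    | linear_combination -c * h₂
    | linear_combination c * h₃
    | linear_combination -c * h₃

variable {i j k : Line} (hij : i ≠ j) (hik : i ≠ k) (hjk : j ≠ k)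
include hij hik hjk

theorem nodeOp_set (M : Bool → Bool → Bool → Bool → Bool → Bool → ℂ) (φ : State → ℂ) (s : State)
    (p q r : Bool) : nodeOp i j k M φ (s.set i j k p q r)
      = ∑ p', ∑ q', ∑ r', M p q r p' q' r' * φ (s.set i j k p' q' r') := by
  have e : ∀ p' q' r' : Bool, update (update (update (s.set i j k p q r) i p') j q') k r'
      = s.set i j k p' q' r' := by
    intro p' q' r'
    funext l
    simp only [State.set, update_apply]
    split_ifs <;> simp_all
  simp only [nodeOp_apply, e]
  simp [State.set, hij, hik, hjk]

/-- The diagonal passes below the crossing of the other two lines. -/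
theorem nodeOp_eq_below (h₁ : b * a₂ = a * b₂ + c * b₃) (h₂ : a₂ * a₃ = b₂ * b₃ + c * a)
    (h₃ : b * a₃ = a * b₃ + c * b₂) :
    nodeOp i j k (node20 (triWeights a b c a₂ b₂ a₃ b₃))
      = crossOp i k (weight6 a₂ b₂ c) * crossOp j k (vertDiag a₃ b₃ c)
        * crossOp i j (horVert a b c) := by
  refine LinearMap.ext fun φ => funext fun s => ?_
  rw [← State.set_self s i j k]
  simp only [Module.End.mul_apply, nodeOp_set hij hik hjk, crossOp_set_left hij hik hjk,
    crossOp_set_mid hij hik, crossOp_set_right hjk, ← sum_below_eq_weight h₁ h₂ h₃,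
    Fintype.sum_bool]
  ring

/-- The diagonal passes above the crossing of the other two lines. -/
theorem nodeOp_eq_above (h₁ : b * a₂ = a * b₂ + c * b₃) (h₂ : a₂ * a₃ = b₂ * b₃ + c * a)
    (h₃ : b * a₃ = a * b₃ + c * b₂) :
    nodeOp i j k (node20 (triWeights a b c a₂ b₂ a₃ b₃))
      = crossOp i j (horVert a b c) * crossOp j k (vertDiag a₃ b₃ c)
        * crossOp i k (weight6 a₂ b₂ c) := by
  refine LinearMap.ext fun φ => funext fun s => ?_
  rw [← State.set_self s i j k]
  simp only [Module.End.mul_apply, nodeOp_set hij hik hjk, crossOp_set_left hij hik hjk,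
    crossOp_set_mid hij hik, crossOp_set_right hjk, ← sum_above_eq_weight h₁ h₂ h₃,
    Fintype.sum_bool]
  ring

/-- The Yang-Baxter equation restricted to functions of the states in which the first and the
third line leave the node unoccupied. It only needs two of the three relations between the
weights. -/
theorem crossOp_below_eq_above {c' : ℂ} (h₁ : c' * b * a₂ = b₂ * a * c' + c * c * b₃)
    (h₂ : c * a₃ * a₂ = b₂ * c * b₃ + c * a * c') {φ : State → ℂ}
    (hi : ∀ s : State, s i = true → φ s = 0) (hk : ∀ s : State, s k = true → φ s = 0) :
    (crossOp i k (weight6 a₂ b₂ c) * crossOp j k (vertDiag a₃ b₃ c')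
        * crossOp i j (horVert a b c)) φ
      = (crossOp i j (horVert a b c) * crossOp j k (vertDiag a₃ b₃ c')
        * crossOp i k (weight6 a₂ b₂ c)) φ := by
  funext s
  rw [← State.set_self s i j k]
  have hi' : ∀ q r, φ (s.set i j k true q r) = 0 := fun q r => hi _ (by simp [State.set, hij, hik])
  have hk' : ∀ p q, φ (s.set i j k p q true) = 0 := fun q r => hk _ (by simp [State.set])
  simp only [Module.End.mul_apply, crossOp_set_left hij hik hjk,
    crossOp_set_mid hij hik, crossOp_set_right hjk, Fintype.sum_bool, hi', hk']
  -- Only two final states survive, told apart by the line `j`; every case is linear in their values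
  -- `f` and `g`.
  generalize φ (s.set i j k false true false) = f
  generalize φ (s.set i j k false false false) = g
  cases s i <;> cases s j <;> cases s k <;>
    simp [weight6, horVert, vertDiag] <;>
    first
    | ring1
    | linear_combination f * h₁
    | linear_combination g * h₁
    | linear_combination -g * h₁
    | linear_combination f * h₂
    | linear_combination g * h₂
    | linear_combination -g * h₂

/-- A node of the last column, as a product of crossings. -/
theorem nodeOp_eq_above_of_exit {c' : ℂ} {M : Bool → Bool → Bool → Bool → Bool → Bool → ℂ}
    (hM : ∀ W S I N, M W S I false N false
      = ∑ p, ∑ q, horVert a b c W S p q * ∑ r, vertDiag a₃ b₃ c' q I N r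
          * weight6 a₂ b₂ c p r false false) {φ : State → ℂ}
    (hi : ∀ s : State, s i = true → φ s = 0) (hk : ∀ s : State, s k = true → φ s = 0) :
    nodeOp i j k M φ
      = (crossOp i j (horVert a b c) * crossOp j k (vertDiag a₃ b₃ c')
        * crossOp i k (weight6 a₂ b₂ c)) φ := by
  funext s
  rw [← State.set_self s i j k]
  have hi' : ∀ q r, φ (s.set i j k true q r) = 0 := fun q r => hi _ (by simp [State.set, hij, hik])
  have hk' : ∀ p q, φ (s.set i j k p q true) = 0 := fun q r => hk _ (by simp [State.set])
  simp only [Module.End.mul_apply, nodeOp_set hij hik hjk, crossOp_set_left hij hik hjk,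
    crossOp_set_mid hij hik, crossOp_set_right hjk, Fintype.sum_bool, hi', hk', hM]
  ring

end YangBaxter

/-! ### Ordered products over rows and triangles -/

open Function

/-- The product `f 0 * f 1 * ... * f (m - 1)`. -/
def rangeProd {M : Type*} [Monoid M] (f : ℕ → M) (m : ℕ) : M := ((List.range m).map f).prod

section RangeProd

variable {M : Type*} [Monoid M] {f g : ℕ → M} {m : ℕ}

@[simp]
theorem rangeProd_zero (f : ℕ → M) : rangeProd f 0 = 1 := rfl

theorem rangeProd_succ (f : ℕ → M) (m : ℕ) : rangeProd f (m + 1) = rangeProd f m * f m :=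
  List.prod_range_succ f m

theorem rangeProd_congr (h : ∀ i < m, f i = g i) : rangeProd f m = rangeProd g m := by
  induction m with
  | zero => rfl
  | succ m ih =>
    rw [rangeProd_succ, rangeProd_succ, ih fun i hi => h i (by omega), h m (by omega)]

theorem rangeProd_induction {p : M → Prop} (one : p 1) (mul : ∀ x y, p x → p y → p (x * y))
    (h : ∀ i < m, p (f i)) : p (rangeProd f m) := by
  induction m with
  | zero => exact one
  | succ m ih =>
    rw [rangeProd_succ]
    exact mul _ _ (ih fun i hi => h i (by omega)) (h m (by omega))

theorem commute_rangeProd {x : M} (h : ∀ i < m, Commute x (f i)) : Commute x (rangeProd f m) :=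
  rangeProd_induction (p := Commute x) (Commute.one_right x) (fun _ _ => Commute.mul_right) h

/-- To separate the factors, each `g i` only has to move to the right past the later `f j`. -/
theorem rangeProd_mul (h : ∀ j < m, ∀ i < j, Commute (f j) (g i)) :
    rangeProd (fun i => f i * g i) m = rangeProd f m * rangeProd g m := by
  induction m with
  | zero => simp
  | succ m ih =>
    rw [rangeProd_succ, rangeProd_succ, rangeProd_succ, ih fun j hj => h j (by omega)]
    have e := (commute_rangeProd (h m (by omega))).eq
    simp only [mul_assoc]
    rw [← mul_assoc (rangeProd g m) (f m), ← e, mul_assoc]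

/-- A mere regrouping of `f 0 g 0 f 1 g 1 ...`; it lets a zigzag below one row be read as a zigzag
above the neighbouring row. -/
theorem rangeProd_mul_succ (f g : ℕ → M) (m : ℕ) :
    rangeProd (fun i => f i * g i) (m + 1)
      = f 0 * rangeProd (fun i => g i * f (i + 1)) m * g m := by
  induction m with
  | zero => simp [rangeProd_succ]
  | succ m ih =>
    rw [rangeProd_succ, ih, rangeProd_succ (fun i => g i * f (i + 1))]
    simp only [mul_assoc]

end RangeProd

/-- The product of `f x y` over the row of the `p` nodes from `(o, o + p - 1)` to
`(o + p - 1, o)`. -/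
def rowProd {M : Type*} [Monoid M] (f : ℕ → ℕ → M) (o p : ℕ) : M :=
  rangeProd (fun i => f (o + i) (o + p - 1 - i)) p

/-- The product over the rows of `0, 1, ..., m - 1` nodes of the lower left triangle. -/
def lowerProd {M : Type*} [Monoid M] (f : ℕ → ℕ → M) (m : ℕ) : M := rangeProd (rowProd f 0) m

/-- The product over the rows of `p, ..., 1` nodes of the upper right triangle. -/
def upperProd {M : Type*} [Monoid M] (f : ℕ → ℕ → M) : ℕ → ℕ → M
  | _, 0 => 1
  | o, p + 1 => rowProd f o (p + 1) * upperProd f (o + 1) p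

/-! ### Locality: propagation of vanishing conditions through operators -/

/-- The values of `T φ` on `X` only depend on those of `φ` on `X`. -/
def StableOn (X : Set State) (T : Module.End ℂ (State → ℂ)) : Prop :=
  ∀ φ ψ : State → ℂ, (∀ s ∈ X, φ s = ψ s) → ∀ s ∈ X, T φ s = T ψ s

namespace StableOn

variable {X : Set State} {T T' : Module.End ℂ (State → ℂ)}

theorem one : StableOn X 1 := fun _ _ h => h

theorem mul (h : StableOn X T) (h' : StableOn X T') : StableOn X (T * T') :=
  fun _ _ e => h _ _ (h' _ _ e)

theorem rangeProd {f : ℕ → Module.End ℂ (State → ℂ)} {m : ℕ} (h : ∀ i < m, StableOn X (f i)) :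
    StableOn X (rangeProd f m) :=
  rangeProd_induction one (fun _ _ => mul) h

theorem vanish (h : StableOn X T) {φ : State → ℂ} (hφ : ∀ s ∈ X, φ s = 0) {s : State}
    (hs : s ∈ X) : T φ s = 0 := by
  rw [h φ 0 hφ s hs, map_zero, Pi.zero_apply]

theorem crossOp {i j : Line} (hi : ∀ s ∈ X, ∀ p, update s i p ∈ X)
    (hj : ∀ s ∈ X, ∀ p, update s j p ∈ X) (M : Bool → Bool → Bool → Bool → ℂ) :
    StableOn X (crossOp i j M) := by
  intro φ ψ e s hs
  rw [crossOp_apply, crossOp_apply]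
  exact Finset.sum_congr rfl fun p _ => Finset.sum_congr rfl fun q _ => by
    rw [e _ (hj _ (hi _ hs p) q)]

theorem nodeOp {i j k : Line} (hi : ∀ s ∈ X, ∀ p, update s i p ∈ X)
    (hj : ∀ s ∈ X, ∀ p, update s j p ∈ X) (hk : ∀ s ∈ X, ∀ p, update s k p ∈ X)
    (M : Bool → Bool → Bool → Bool → Bool → Bool → ℂ) : StableOn X (nodeOp i j k M) := by
  intro φ ψ e s hs
  rw [nodeOp_apply, nodeOp_apply]
  exact Finset.sum_congr rfl fun p _ => Finset.sum_congr rfl fun q _ =>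
    Finset.sum_congr rfl fun r _ => by rw [e _ (hk _ (hj _ (hi _ hs p) q) r)]

end StableOn

/-! ### Sliding a diagonal across a row -/

/-- The weights of the model: those of the three kinds of crossings, the modified weights in the
last column (`bL`, `b₃L`, `c₃L`), and the corresponding factors `τ`, `g` of the node weights. -/
structure Weights where
  (a b c a₂ b₂ a₃ b₃ bL b₃L c₃L τ g : ℂ)

/-- The relations behind the Yang-Baxter equation. -/
structure Weights.Compatible (w : Weights) : Prop where
  hor : w.b * w.a₂ = w.a * w.b₂ + w.c * w.b₃
  prod : w.a₂ * w.a₃ = w.b₂ * w.b₃ + w.c * w.a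
  vert : w.b * w.a₃ = w.a * w.b₃ + w.c * w.b₂
  horL : w.c₃L * w.bL * w.a₂ = w.b₂ * w.a * w.c₃L + w.c * w.c * w.b₃L
  prodL : w.c * w.a₃ * w.a₂ = w.b₂ * w.c * w.b₃L + w.c * w.a * w.c₃L
  tau_eq : w.τ * (w.b * w.b₃) = w.bL * w.b₃L
  g_eq : w.g * (w.c * w.b) = w.c₃L * w.bL

namespace Weights

variable (w : Weights) (n : ℕ)

/-- The weights of the crossing of the vertical line `x` and a horizontal line. -/
def hvWeight (x : ℕ) : Bool → Bool → Bool → Bool → ℂ :=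
  horVert w.a (if x + 1 = n then w.bL else w.b) w.c

/-- The weights of the crossing of the vertical line `x` and a diagonal line. -/
def vdWeight (x : ℕ) : Bool → Bool → Bool → Bool → ℂ :=
  vertDiag w.a₃ (if x + 1 = n then w.b₃L else w.b₃) (if x + 1 = n then w.c₃L else w.c)

/-- The modified weights of the nodes of the column `x`. -/
def nodeWeight (x : ℕ) (W S I E N O : Bool) : ℂ :=
  (if x + 1 = n then (if N then w.τ else if I then w.g else 1) else 1)
    * node20 (triWeights w.a w.b w.c w.a₂ w.b₂ w.a₃ w.b₃) W S I E N O

def hv (x y : ℕ) : Module.End ℂ (State → ℂ) := crossOp (.h y) (.v x) (w.hvWeight n x)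

def hd (y k : ℕ) : Module.End ℂ (State → ℂ) := crossOp (.h y) (.d k) (weight6 w.a₂ w.b₂ w.c)

def vd (x k : ℕ) : Module.End ℂ (State → ℂ) := crossOp (.v x) (.d k) (w.vdWeight n x)

def node (x y : ℕ) : Module.End ℂ (State → ℂ) :=
  nodeOp (.h y) (.v x) (.d (x + y + 1)) (w.nodeWeight n x)

/-- The row of the `p` nodes from `(o, o + p - 1)` to `(o + p - 1, o)`, without diagonals. -/
def row6 (o p : ℕ) : Module.End ℂ (State → ℂ) :=
  rowProd (w.hv n) o p

/-- The row of the `p` nodes from `(o, o + p - 1)` to `(o + p - 1, o)`. -/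
def row20 (o p : ℕ) : Module.End ℂ (State → ℂ) :=
  rowProd (w.node n) o p

/-- The diagonal `k` passes below a row. -/
def diagBelow (o p k : ℕ) : Module.End ℂ (State → ℂ) :=
  rangeProd (fun i => w.hd (o + p - 1 - i) k * w.vd n (o + i) k) p

/-- The diagonal `k` passes above a row. -/
def diagAbove (o p k : ℕ) : Module.End ℂ (State → ℂ) :=
  rangeProd (fun i => w.vd n (o + i) k * w.hd (o + p - 1 - i) k) p

variable {w n}

theorem commute_hd_hv {y k x y' : ℕ} (h : y ≠ y') : Commute (w.hd y k) (w.hv n x y') :=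
  crossOp_commute (by simpa using h) (by simp) (by simp) (by simp) _ _

theorem commute_vd_hv {x k x' y : ℕ} (h : x ≠ x') : Commute (w.vd n x k) (w.hv n x' y) :=
  crossOp_commute (by simp) (by simpa using h) (by simp) (by simp) _ _

/-- The zigzag below the row of `m + 1` nodes runs between that row and the row of `m` nodes. Seen
from the latter it passes above, with one crossing left over at each end. -/
theorem diagBelow_zero_succ (m k : ℕ) :
    w.diagBelow n 0 (m + 1) k = w.hd m k * w.diagAbove n 0 m k * w.vd n m k := by
  have e : rangeProd (fun i => w.vd n i k * w.hd (m - (i + 1)) k) m = w.diagAbove n 0 m k :=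
    rangeProd_congr fun i _ => by
      rw [Nat.zero_add, Nat.zero_add, show m - (i + 1) = m - 1 - i by omega]
  unfold diagBelow
  rw [rangeProd_mul_succ (fun i => w.hd (0 + (m + 1) - 1 - i) k) (fun i => w.vd n (0 + i) k)]
  simp only [Nat.zero_add, Nat.add_sub_cancel, Nat.sub_zero]
  rw [e]

/-- The counterpart in the upper triangle, where the next row is the shorter one: the same zigzag
passes below it, up to the two end crossings. -/
theorem diagAbove_succ (o p k : ℕ) :
    w.diagAbove n o (p + 1) k = w.vd n o k * w.diagBelow n (o + 1) p k * w.hd o k := by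
  have e : rangeProd (fun i => w.hd (o + (p + 1) - 1 - i) k * w.vd n (o + (i + 1)) k) p
      = w.diagBelow n (o + 1) p k :=
    rangeProd_congr fun i _ => by
      rw [show o + (p + 1) - 1 - i = o + 1 + p - 1 - i by omega,
        show o + (i + 1) = o + 1 + i by omega]
  unfold diagAbove
  rw [rangeProd_mul_succ (fun i => w.vd n (o + i) k) (fun i => w.hd (o + (p + 1) - 1 - i) k), e,
    Nat.add_zero, show o + (p + 1) - 1 - p = o by omega]

/-- Distinct nodes of a row share neither a horizontal nor a vertical line, so the crossings of the
diagonal separate from those of the row. -/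
theorem rangeProd_below (o p k : ℕ) :
    rangeProd (fun i => w.hd (o + p - 1 - i) k * w.vd n (o + i) k
      * w.hv n (o + i) (o + p - 1 - i)) p = w.diagBelow n o p k * w.row6 n o p :=
  rangeProd_mul fun _ _ _ _ =>
    Commute.mul_left (commute_hd_hv (by omega)) (commute_vd_hv (by omega))

theorem rangeProd_above (o p k : ℕ) :
    rangeProd (fun i => w.hv n (o + i) (o + p - 1 - i) * w.vd n (o + i) k
      * w.hd (o + p - 1 - i) k) p = w.row6 n o p * w.diagAbove n o p k := by
  have := rangeProd_mul (m := p) (f := fun i => w.hv n (o + i) (o + p - 1 - i))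
    (g := fun i => w.vd n (o + i) k * w.hd (o + p - 1 - i) k) fun _ _ _ _ =>
    Commute.mul_right (commute_vd_hv (by omega)).symm (commute_hd_hv (by omega)).symm
  simpa only [mul_assoc, row6, rowProd, diagAbove] using this

section Compatible

variable (hw : w.Compatible)
include hw

theorem below_eq_above {x y k : ℕ} (hx : x + 1 ≠ n) :
    w.hd y k * w.vd n x k * w.hv n x y = w.hv n x y * w.vd n x k * w.hd y k := by
  simp only [hd, vd, hv, hvWeight, vdWeight, if_neg hx]
  rw [← nodeOp_eq_below (by simp) (by simp) (by simp) hw.hor hw.prod hw.vert,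
    ← nodeOp_eq_above (by simp) (by simp) (by simp) hw.hor hw.prod hw.vert]

theorem node_eq_below {x y : ℕ} (hx : x + 1 ≠ n) :
    w.node n x y = w.hd y (x + y + 1) * w.vd n x (x + y + 1) * w.hv n x y := by
  have e : w.nodeWeight n x = node20 (triWeights w.a w.b w.c w.a₂ w.b₂ w.a₃ w.b₃) := by
    funext W S I E N O
    simp [nodeWeight, hx]
  simp only [hd, vd, hv, hvWeight, vdWeight, if_neg hx, node, e]
  exact nodeOp_eq_below (by simp) (by simp) (by simp) hw.hor hw.prod hw.vert

/-- The modified weights are only subject to `horL` and `prodL`; the vanishing of `φ` encodes that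
nothing leaves the last column by its horizontal or diagonal exits. -/
theorem below_eq_above_last {x y k : ℕ} (hx : x + 1 = n) {φ : State → ℂ}
    (hi : ∀ s : State, s (.h y) = true → φ s = 0) (hk : ∀ s : State, s (.d k) = true → φ s = 0) :
    (w.hd y k * w.vd n x k * w.hv n x y) φ = (w.hv n x y * w.vd n x k * w.hd y k) φ := by
  simp only [hd, vd, hv, hvWeight, vdWeight, if_pos hx]
  exact crossOp_below_eq_above (by simp) (by simp) (by simp) hw.horL hw.prodL hi hk

/-- With the diagonal above, each entry with empty exits is a single product. A path from the North
gets `bL * b₃L`, a path from the Northwest `c₃L * bL`, and a path from the West no modified weight;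
`tau_eq` and `g_eq` convert the first two into the factors `τ` and `g`. The restricted Yang-Baxter
equation then moves the diagonal below. -/
theorem node_eq_below_last {x y : ℕ} (hx : x + 1 = n) {φ : State → ℂ}
    (hi : ∀ s : State, s (.h y) = true → φ s = 0)
    (hk : ∀ s : State, s (.d (x + y + 1)) = true → φ s = 0) :
    w.node n x y φ = (w.hd y (x + y + 1) * w.vd n x (x + y + 1) * w.hv n x y) φ := by
  rw [below_eq_above_last hw hx hi hk]
  simp only [hd, vd, hv, hvWeight, vdWeight, if_pos hx, node]
  refine nodeOp_eq_above_of_exit (by simp) (by simp) (by simp) ?_ hi hk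
  intro W S I N
  cases W <;> cases S <;> cases I <;> cases N <;>
    simp [hx, nodeWeight, weight6, horVert, vertDiag, node20, weight20, triWeights] <;>
    first
    | ring1
    | linear_combination w.a₂ * hw.tau_eq
    | linear_combination w.a₂ * hw.g_eq

theorem diagBelow_mul_row6 {o p : ℕ} (h : o + p < n) (k : ℕ) :
    w.diagBelow n o p k * w.row6 n o p = w.row6 n o p * w.diagAbove n o p k := by
  rw [← rangeProd_below, ← rangeProd_above]
  exact rangeProd_congr fun i _ => below_eq_above hw (by omega)

theorem row20_eq {p : ℕ} (h : p < n) :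
    w.row20 n 0 p = w.diagBelow n 0 p p * w.row6 n 0 p := by
  rw [← rangeProd_below]
  refine rangeProd_congr fun i _ => ?_
  rw [node_eq_below hw (by omega), show 0 + i + (0 + p - 1 - i) + 1 = p by omega]

theorem diagBelow_row6_apply {o p k : ℕ} (h : o + (p + 1) = n) {φ : State → ℂ}
    (hi : ∀ s : State, s (.h o) = true → φ s = 0) (hk : ∀ s : State, s (.d k) = true → φ s = 0) :
    w.diagBelow n o (p + 1) k (w.row6 n o (p + 1) φ)
      = w.row6 n o (p + 1) (w.diagAbove n o (p + 1) k φ) := by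
  simp only [← Module.End.mul_apply]
  rw [← rangeProd_below, ← rangeProd_above, rangeProd_succ, rangeProd_succ,
    Module.End.mul_apply (rangeProd _ _), Module.End.mul_apply (rangeProd _ _)]
  -- The rightmost factor is the node `(n - 1, o)`, the only one of the row in the last column. It
  -- acts on `φ` first, so the vanishing conditions apply to it directly.
  rw [below_eq_above_last hw (by omega) (by simpa using hi) hk]
  congr 1
  exact rangeProd_congr fun i _ => below_eq_above hw (by omega)

theorem row20_apply {o p : ℕ} (h : o + (p + 1) = n) {φ : State → ℂ}
    (hi : ∀ s : State, s (.h o) = true → φ s = 0)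
    (hk : ∀ s : State, s (.d (o + n)) = true → φ s = 0) :
    w.row20 n o (p + 1) φ = w.diagBelow n o (p + 1) (o + n) (w.row6 n o (p + 1) φ) := by
  have e : ∀ i < p + 1, o + i + (o + (p + 1) - 1 - i) + 1 = o + n := fun i _ => by omega
  rw [← Module.End.mul_apply, ← rangeProd_below, row20, rowProd, rangeProd_succ, rangeProd_succ,
    Module.End.mul_apply, Module.End.mul_apply]
  rw [node_eq_below_last hw (by omega) (by simpa using hi) (by rw [e p (by omega)]; exact hk),
    e p (by omega)]
  congr 1
  exact rangeProd_congr fun i hi => by rw [node_eq_below hw (by omega), e i (by omega)]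

end Compatible

/-! ### Frozen crossings outside the square -/

section Frozen

variable {φ : State → ℂ} {s : State} {x y k : ℕ}

theorem update_update_eq_self {i j : Line} {p q : Bool} (hi : s i = p) (hj : s j = q) :
    update (update s i p) j q = s := by
  subst hi hj
  simp only [update_eq_self]

theorem hd_apply_of_occupied (hh : s (.h y) = true) (hd : s (.d k) = true) :
    w.hd y k φ s = w.a₂ * φ s := by
  simp [Weights.hd, crossOp_apply, hh, hd, weight6, update_update_eq_self hh hd]

/-- The vertical line is read upwards, against the direction of the paths, so two occupied edges may
turn into two empty ones; `hφ` excludes this, and only the weight `a₃` remains. -/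
theorem vd_apply_of_occupied (hv : s (.v x) = true) (hd : s (.d k) = true)
    (hφ : φ (update (update s (.v x) false) (.d k) false) = 0) :
    w.vd n x k φ s = w.a₃ * φ s := by
  simp [Weights.vd, vdWeight, vertDiag, crossOp_apply, hv, hd, weight6, hφ,
    update_update_eq_self hv hd]

/-- No path arrives, either from the North or from the Northwest, hence the crossing is empty. Its
weight is `a₃` in the last column too, so the frozen factors do not feel the modification. -/
theorem vd_apply_of_exit (hv : ∀ s : State, s (.v x) = true → φ s = 0) (hd : s (.d k) = false) :
    w.vd n x k φ s = w.a₃ * φ s := by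
  simp only [Weights.vd, vdWeight, vertDiag, crossOp_apply, Fintype.sum_bool, hd]
  rw [hv (update (update s _ true) _ _) (by simp), hv (update (update s _ true) _ _) (by simp)]
  cases h : s (.v x)
  · simp [weight6, update_update_eq_self h hd]
  · simp [weight6, hv s h]

theorem hd_apply_of_exit (hi : ∀ s : State, s (.h y) = true → φ s = 0)
    (hk : ∀ s : State, s (.d k) = true → φ s = 0) : w.hd y k φ = w.a₂ • φ := by
  funext s
  simp only [Weights.hd, crossOp_apply, Fintype.sum_bool, Pi.smul_apply, smul_eq_mul]
  rw [hi (update (update s _ true) _ true) (by simp), hi (update (update s _ true) _ _) (by simp),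
    hk (update (update s _ _) _ true) (by simp)]
  cases hh : s (.h y)
  · cases hd : s (.d k)
    · simp [weight6, update_update_eq_self hh hd]
    · simp [weight6, hk s hd]
  · cases hd : s (.d k) <;> simp [weight6, hi s hh]

end Frozen

section Stable

variable {X : Set State}

theorem stableOn_row6 {o p : ℕ}
    (hh : ∀ s ∈ X, ∀ y, o ≤ y → y < o + p → ∀ b, update s (.h y) b ∈ X)
    (hv : ∀ s ∈ X, ∀ x, o ≤ x → x < o + p → ∀ b, update s (.v x) b ∈ X) :
    StableOn X (w.row6 n o p) :=
  .rangeProd fun _ _ => .crossOp (fun s hs => hh s hs _ (by omega) (by omega))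
    (fun s hs => hv s hs _ (by omega) (by omega)) _

theorem stableOn_row20 {o p : ℕ}
    (hh : ∀ s ∈ X, ∀ y, o ≤ y → y < o + p → ∀ b, update s (.h y) b ∈ X)
    (hv : ∀ s ∈ X, ∀ x, o ≤ x → x < o + p → ∀ b, update s (.v x) b ∈ X)
    (hd : ∀ s ∈ X, ∀ b, update s (.d (o + (o + p))) b ∈ X) :
    StableOn X (w.row20 n o p) := by
  refine .rangeProd fun i hi => .nodeOp (fun s hs => hh s hs _ (by omega) (by omega))
    (fun s hs => hv s hs _ (by omega) (by omega)) ?_ _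
  rw [show o + i + (o + p - 1 - i) + 1 = o + (o + p) by omega]
  exact hd

theorem stableOn_diagBelow {o p k : ℕ}
    (hh : ∀ s ∈ X, ∀ y, o ≤ y → y < o + p → ∀ b, update s (.h y) b ∈ X)
    (hv : ∀ s ∈ X, ∀ x, o ≤ x → x < o + p → ∀ b, update s (.v x) b ∈ X)
    (hd : ∀ s ∈ X, ∀ b, update s (.d k) b ∈ X) :
    StableOn X (w.diagBelow n o p k) :=
  .rangeProd fun _ _ => .mul (.crossOp (fun s hs => hh s hs _ (by omega) (by omega)) hd _)
    (.crossOp (fun s hs => hv s hs _ (by omega) (by omega)) hd _)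

end Stable

variable (w n)

/-- The rows of `0, 1, ..., m - 1` nodes of the lower left triangle, without diagonals. -/
def lower6 (m : ℕ) : Module.End ℂ (State → ℂ) := lowerProd (w.hv n) m

/-- The rows of `0, 1, ..., m - 1` nodes of the lower left triangle. -/
def lower20 (m : ℕ) : Module.End ℂ (State → ℂ) := lowerProd (w.node n) m

/-- The rows of `p, ..., 1` nodes of the upper right triangle, without diagonals. -/
def upper6 (o p : ℕ) : Module.End ℂ (State → ℂ) := upperProd (w.hv n) o p

/-- The rows of `p, ..., 1` nodes of the upper right triangle. -/
def upper20 (o p : ℕ) : Module.End ℂ (State → ℂ) := upperProd (w.node n) o p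

variable {w n}

theorem lower6_succ (m : ℕ) : w.lower6 n (m + 1) = w.lower6 n m * w.row6 n 0 m :=
  rangeProd_succ _ _

theorem lower20_succ (m : ℕ) : w.lower20 n (m + 1) = w.lower20 n m * w.row20 n 0 m :=
  rangeProd_succ _ _

theorem upper6_succ (o p : ℕ) :
    w.upper6 n o (p + 1) = w.row6 n o (p + 1) * w.upper6 n (o + 1) p := rfl

theorem upper20_succ (o p : ℕ) :
    w.upper20 n o (p + 1) = w.row20 n o (p + 1) * w.upper20 n (o + 1) p := rfl

theorem stableOn_lower6 {X : Set State} {m : ℕ}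
    (hh : ∀ s ∈ X, ∀ y, y + 1 < m → ∀ b, update s (.h y) b ∈ X)
    (hv : ∀ s ∈ X, ∀ x, x + 1 < m → ∀ b, update s (.v x) b ∈ X) :
    StableOn X (w.lower6 n m) :=
  .rangeProd fun _ _ => stableOn_row6 (fun s hs y _ _ => hh s hs y (by omega))
    (fun s hs x _ _ => hv s hs x (by omega))

theorem stableOn_upper6 {X : Set State} {o p : ℕ}
    (hh : ∀ s ∈ X, ∀ y, o ≤ y → ∀ b, update s (.h y) b ∈ X)
    (hv : ∀ s ∈ X, ∀ x, o ≤ x → ∀ b, update s (.v x) b ∈ X) :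
    StableOn X (w.upper6 n o p) := by
  induction p generalizing o with
  | zero => exact .one
  | succ p ih =>
    exact .mul (stableOn_row6 (fun s hs y h _ => hh s hs y h) (fun s hs x h _ => hv s hs x h))
      (ih (fun s hs y h => hh s hs y (by omega)) (fun s hs x h => hv s hs x (by omega)))

theorem stableOn_upper20 {X : Set State} {o p : ℕ}
    (hh : ∀ s ∈ X, ∀ y, o ≤ y → ∀ b, update s (.h y) b ∈ X)
    (hv : ∀ s ∈ X, ∀ x, o ≤ x → ∀ b, update s (.v x) b ∈ X)
    (hd : ∀ s ∈ X, ∀ k, o + (o + p) ≤ k → ∀ b, update s (.d k) b ∈ X) :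
    StableOn X (w.upper20 n o p) := by
  induction p generalizing o with
  | zero => exact .one
  | succ p ih =>
    exact .mul (stableOn_row20 (fun s hs y h _ => hh s hs y h) (fun s hs x h _ => hv s hs x h)
      (fun s hs => hd s hs _ le_rfl))
      (ih (fun s hs y h => hh s hs y (by omega)) (fun s hs x h => hv s hs x (by omega))
        (fun s hs k h => hd s hs k (by omega)))

/-! ### Moving all the diagonals out of the square -/

section Unraveling

variable (hw : w.Compatible)
include hw

/-- An occupied diagonal can be moved out of the lower left triangle. -/
theorem lower6_diagBelow_apply {m : ℕ} (hm : m < n) {k : ℕ} {s : State}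
    (hsh : ∀ y, s (.h y) = true) (hsv : ∀ x, s (.v x) = true) (hsd : s (.d k) = true)
    {φ : State → ℂ} (hφ : ∀ s : State, s (.d k) = false → (∀ x, m ≤ x → s (.v x) = true) → φ s = 0) :
    w.lower6 n m (w.diagBelow n 0 m k φ) s = (w.a₂ * w.a₃) ^ m * w.lower6 n m φ s := by
  induction m generalizing φ with
  | zero => simp [diagBelow, rangeProd_zero]
  | succ m ih =>
    have c₂ : Commute (w.hd m k) (w.lower6 n (m + 1)) :=
      commute_rangeProd fun i hi => commute_rangeProd fun j hj => commute_hd_hv (by omega)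
    have c₃ : Commute (w.vd n m k) (w.lower6 n (m + 1)) :=
      commute_rangeProd fun i hi => commute_rangeProd fun j hj => commute_vd_hv (by omega)
    -- The crossing with the horizontal line `m` commutes with the shorter rows and comes out in
    -- front; the rest of the zigzag crosses the row of `m` nodes by the Yang-Baxter equation. This
    -- leaves the same problem for `m`.
    have e : w.lower6 n (m + 1) * w.diagBelow n 0 (m + 1) k
        = w.hd m k * (w.lower6 n m * (w.diagBelow n 0 m k * w.row6 n 0 m) * w.vd n m k) := by
      rw [diagBelow_mul_row6 hw (by omega), diagBelow_zero_succ, ← mul_assoc, ← mul_assoc, ← c₂.eq,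
        lower6_succ]
      simp only [mul_assoc]
    have van : ∀ s : State, s (.d k) = false → (∀ x, m + 1 ≤ x → s (.v x) = true) →
        w.lower6 n (m + 1) φ s = 0 := by
      intro s h h'
      refine (stableOn_lower6 (X := {s : State | s (.d k) = false ∧ ∀ x, m + 1 ≤ x → s (.v x) = true})
        ?_ ?_).vanish (fun s hs => hφ s hs.1 hs.2) ⟨h, h'⟩
      · rintro s ⟨hs, hs'⟩ y hy b
        exact ⟨by simpa using hs, fun x hx => by simpa using hs' x hx⟩
      · rintro s ⟨hs, hs'⟩ y hy b
        exact ⟨by simpa using hs, fun x hx => by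
          rw [update_of_ne (by simp; omega)]; exact hs' x hx⟩
    rw [← Module.End.mul_apply, e, Module.End.mul_apply, hd_apply_of_occupied (hsh m) hsd]
    simp only [Module.End.mul_apply]
    rw [ih (by omega), ← Module.End.mul_apply, ← Module.End.mul_apply, ← lower6_succ, ← c₃.eq,
      Module.End.mul_apply, vd_apply_of_occupied (hsv m) hsd]
    · ring
    · refine van _ (by simp) fun x hx => ?_
      rw [update_of_ne (by simp), update_of_ne (by simp; omega)]
      exact hsv x
    -- An empty diagonal can become occupied at the vertical line `m` only if that line is
    -- unoccupied. Hence the vanishing hypothesis of the induction is restricted to states in which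
    -- the vertical lines from `m` on are occupied.
    · intro s h h'
      refine (stableOn_row6 (X := {s : State | s (.d k) = false ∧ ∀ x, m ≤ x → s (.v x) = true})
        ?_ ?_).vanish ?_ ⟨h, h'⟩
      · rintro s ⟨hs, hs'⟩ y - hy b
        exact ⟨by simpa using hs, fun x hx => by simpa using hs' x hx⟩
      · rintro s ⟨hs, hs'⟩ y - hy b
        exact ⟨by simpa using hs, fun x hx => by
          rw [update_of_ne (by simp; omega)]; exact hs' x hx⟩
      · rintro s ⟨hs, hs'⟩
        simp only [vd, vdWeight, vertDiag, crossOp_apply, Fintype.sum_bool, hs, hs' m le_rfl]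
        rw [hφ (update (update s _ _) _ false) (by simp) fun x hx => by
          rw [update_of_ne (by simp), update_of_ne (by simp; omega)]; exact hs' x (by omega),
          hφ (update (update s _ _) _ false) (by simp) fun x hx => by
          rw [update_of_ne (by simp), update_of_ne (by simp; omega)]; exact hs' x (by omega)]
        simp [weight6]

/-- The diagonal `k` runs through the row of `k` nodes and meets `k` horizontal and `k` vertical
lines, whence `(a₂ a₃) ^ k`. These rows avoid the last column, so only the ordinary weights occur.
-/
theorem lower20_apply {m : ℕ} (hm : m ≤ n) {s : State}
    (hsh : ∀ y, s (.h y) = true) (hsv : ∀ x, s (.v x) = true)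
    (hsd : ∀ k, 0 < k → k < n → s (.d k) = true)
    {φ : State → ℂ} (hφ : ∀ k, 0 < k → k < m → ∀ s : State, s (.d k) = false → φ s = 0) :
    w.lower20 n m φ s = (w.a₂ * w.a₃) ^ (∑ i ∈ Finset.range m, i) * w.lower6 n m φ s := by
  induction m generalizing φ with
  | zero => simp [lower20, lower6, lowerProd]
  | succ m ih =>
    rw [lower20_succ, lower6_succ, Module.End.mul_apply, Module.End.mul_apply, ih (by omega), row20_eq hw (by omega),
      Module.End.mul_apply, Finset.sum_range_succ, pow_add, mul_assoc]
    · congr 1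
      rcases Nat.eq_zero_or_pos m with rfl | hm'
      · simp [diagBelow]
      · refine lower6_diagBelow_apply hw (by omega) hsh hsv (hsd m hm' (by omega)) ?_
        intro s h _
        refine (stableOn_row6 (X := {s : State | s (.d m) = false}) ?_ ?_).vanish
          (fun s hs => hφ m hm' (by omega) s hs) h
        all_goals
          intro s hs y _ _ b
          simpa using hs
    · intro k hk hkm s hs
      refine (stableOn_row20 (X := {s : State | s (.d k) = false}) ?_ ?_ ?_).vanish
          (fun s hs => hφ k hk (by omega) s hs) hs
      · intro s hs y _ _ b
        simpa using hs
      · intro s hs y _ _ b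
        simpa using hs
      · intro s hs b
        rw [Set.mem_ofPred_eq, update_of_ne (by simp; omega)]
        exact hs

/-- An empty diagonal can be moved out of the upper right triangle. -/
theorem diagBelow_upper6_apply {p o : ℕ} (h : o + p = n) {k : ℕ} {φ : State → ℂ}
    (hφh : ∀ y < n, ∀ s : State, s (.h y) = true → φ s = 0)
    (hφv : ∀ x < n, ∀ s : State, s (.v x) = true → φ s = 0)
    (hφd : ∀ s : State, s (.d k) = true → φ s = 0) {s : State} (hs : s (.d k) = false) :
    w.diagBelow n o p k (w.upper6 n o p φ) s = (w.a₂ * w.a₃) ^ p * w.upper6 n o p φ s := by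
  induction p generalizing o s with
  | zero => simp [diagBelow]
  | succ p ih =>
    have vh : ∀ s : State, s (.h o) = true → w.upper6 n (o + 1) p φ s = 0 := by
      intro s hs
      refine (stableOn_upper6 (X := {s : State | s (.h o) = true}) ?_ ?_).vanish
        (fun s hs => hφh o (by omega) s hs) hs
      · intro s hs y hy b
        rw [Set.mem_ofPred_eq, update_of_ne (by simp; omega)]
        exact hs
      · intro s hs y _ b
        simpa using hs
    have vv : ∀ s : State, s (.v o) = true → w.upper6 n (o + 1) p φ s = 0 := by
      intro s hs
      refine (stableOn_upper6 (X := {s : State | s (.v o) = true}) ?_ ?_).vanish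
        (fun s hs => hφv o (by omega) s hs) hs
      · intro s hs y _ b
        simpa using hs
      · intro s hs y hy b
        rw [Set.mem_ofPred_eq, update_of_ne (by simp; omega)]
        exact hs
    have vd : ∀ s : State, s (.d k) = true → w.upper6 n (o + 1) p φ s = 0 := by
      intro s hs
      refine (stableOn_upper6 (X := {s : State | s (.d k) = true}) ?_ ?_).vanish
        (fun s hs => hφd s hs) hs
      · intro s hs y _ b
        simpa using hs
      · intro s hs y hy b
        simpa using hs
    have vv' : ∀ s : State, s (.v o) = true →
        w.diagBelow n (o + 1) p k (w.upper6 n (o + 1) p φ) s = 0 := by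
      intro s hs
      refine (stableOn_diagBelow (X := {s : State | s (.v o) = true}) ?_ ?_ ?_).vanish
        (fun s hs => vv s hs) hs
      · intro s hs y _ _ b
        simpa using hs
      · intro s hs y hy _ b
        rw [Set.mem_ofPred_eq, update_of_ne (by simp; omega)]
        exact hs
      · intro s hs b
        simpa using hs
    have st : StableOn {s : State | s (.d k) = false} (w.row6 n o (p + 1)) :=
      stableOn_row6 (fun s hs y _ _ b => by simpa using hs) (fun s hs y _ _ b => by simpa using hs)
    simp only [upper6_succ, Module.End.mul_apply]
    -- The lines `h o` and `v o` meet no later row. The two leftover crossings therefore see lines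
    -- that leave empty, and contribute `a₂` and `a₃`.
    rw [diagBelow_row6_apply hw h vh vd, diagAbove_succ, Module.End.mul_apply,
      Module.End.mul_apply, hd_apply_of_exit vh vd]
    refine (st _ ((w.a₂ * w.a₃) ^ (p + 1) • w.upper6 n (o + 1) p φ) (fun s hs => ?_) s hs).trans
      (by rw [map_smul]; rfl)
    rw [map_smul, map_smul, Pi.smul_apply, vd_apply_of_exit vv' hs, ih (by omega) hs,
      Pi.smul_apply, smul_eq_mul, smul_eq_mul]
    ring

/-- The row of `p` nodes carries the diagonal `o + n`. The sum runs up to `p` included, because for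
`o = 0` the first row is the full antidiagonal of `n` nodes. -/
theorem upper20_apply {p o : ℕ} (h : o + p = n) {φ : State → ℂ}
    (hφh : ∀ y < n, ∀ s : State, s (.h y) = true → φ s = 0)
    (hφv : ∀ x < n, ∀ s : State, s (.v x) = true → φ s = 0)
    (hφd : ∀ k, n ≤ k → k < 2 * n → ∀ s : State, s (.d k) = true → φ s = 0) {s : State}
    (hs : ∀ k, o + n ≤ k → k < 2 * n → s (.d k) = false) :
    w.upper20 n o p φ s
      = (w.a₂ * w.a₃) ^ (∑ i ∈ Finset.range (p + 1), i) * w.upper6 n o p φ s := by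
  induction p generalizing o s with
  | zero => simp [upper6, upper20, upperProd]
  | succ p ih =>
    have vh : ∀ s : State, s (.h o) = true → w.upper6 n (o + 1) p φ s = 0 := by
      intro s hs
      refine (stableOn_upper6 (X := {s : State | s (.h o) = true}) ?_ ?_).vanish
        (fun s hs => hφh o (by omega) s hs) hs
      · intro s hs y hy b
        rw [Set.mem_ofPred_eq, update_of_ne (by simp; omega)]
        exact hs
      · intro s hs y _ b
        simpa using hs
    have vd : ∀ s : State, s (.d (o + n)) = true → w.upper6 n (o + 1) p φ s = 0 := by
      intro s hs
      refine (stableOn_upper6 (X := {s : State | s (.d (o + n)) = true}) ?_ ?_).vanish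
        (fun s hs => hφd _ (by omega) (by omega) s hs) hs
      · intro s hs y _ b
        simpa using hs
      · intro s hs y hy b
        simpa using hs
    have st : StableOn {s : State | ∀ k, o + 1 + n ≤ k → k < 2 * n → s (.d k) = false}
        (w.row20 n o (p + 1)) := by
      refine stableOn_row20 (fun s hs y _ _ b => by simpa using hs)
        (fun s hs y _ _ b => by simpa using hs) (fun s hs b k hk hk' => ?_)
      rw [update_of_ne (by simp; omega)]
      exact hs k hk hk'
    have e := st (w.upper20 n (o + 1) p φ)
      ((w.a₂ * w.a₃) ^ (∑ i ∈ Finset.range (p + 1), i) • w.upper6 n (o + 1) p φ)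
      (fun s hs => ih (by omega) hs) s (fun k hk hk' => hs k (by omega) hk')
    rw [upper20_succ, Module.End.mul_apply, e, map_smul, Pi.smul_apply, smul_eq_mul,
      row20_apply hw h vh vd, ← Module.End.mul_apply (w.row6 n o (p + 1)), ← upper6_succ,
      diagBelow_upper6_apply hw h hφh hφv (hφd _ (by omega) (by omega))
        (hs _ le_rfl (by omega)), Finset.sum_range_succ _ (p + 1),
      pow_add _ (∑ i ∈ Finset.range (p + 1), i) (p + 1), mul_assoc]

/-- The nodes of the 20V model are those of the 6V model up to a factor. -/
theorem lower20_upper20_apply {φ : State → ℂ} {s : State}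
    (hsh : ∀ y, s (.h y) = true) (hsv : ∀ x, s (.v x) = true)
    (hsd : ∀ k, 0 < k → k < n → s (.d k) = true)
    (hsd' : ∀ k, n ≤ k → k < 2 * n → s (.d k) = false)
    (hφh : ∀ y < n, ∀ s : State, s (.h y) = true → φ s = 0)
    (hφv : ∀ x < n, ∀ s : State, s (.v x) = true → φ s = 0)
    (hφd : ∀ k, 0 < k → k < n → ∀ s : State, s (.d k) = false → φ s = 0)
    (hφd' : ∀ k, n ≤ k → k < 2 * n → ∀ s : State, s (.d k) = true → φ s = 0) :
    w.lower20 n n (w.upper20 n 0 n φ) s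
      = (w.a₂ * w.a₃) ^ (n ^ 2) * w.lower6 n n (w.upper6 n 0 n φ) s := by
  rw [lower20_apply hw le_rfl hsh hsv hsd]
  · have e := stableOn_lower6 (w := w) (n := n) (m := n)
      (X := {s : State | ∀ k, n ≤ k → k < 2 * n → s (.d k) = false})
      (fun s hs y _ b => by simpa using hs) (fun s hs y _ b => by simpa using hs)
      (w.upper20 n 0 n φ)
      ((w.a₂ * w.a₃) ^ (∑ i ∈ Finset.range (n + 1), i) • w.upper6 n 0 n φ)
      (fun s hs => upper20_apply hw (by omega) hφh hφv hφd' (by simpa using hs)) s hsd'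
    rw [e, map_smul, Pi.smul_apply, smul_eq_mul, ← mul_assoc, ← pow_add]
    congr 2
    -- The exponents of the two triangles add up: `n (n - 1) / 2 + n (n + 1) / 2 = n ^ 2`.
    rw [Finset.sum_range_succ, ← add_assoc, ← mul_two, Finset.sum_range_id_mul_two]
    cases n with
    | zero => rfl
    | succ n => simp only [Nat.add_sub_cancel]; ring
  · intro k hk hkn s hs
    refine (stableOn_upper20 (X := {s : State | s (.d k) = false}) ?_ ?_ ?_).vanish
      (fun s hs => hφd k hk hkn s hs) hs
    · intro s hs y _ b
      simpa using hs
    · intro s hs y _ b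
      simpa using hs
    · intro s hs k' hk' b
      rw [Set.mem_ofPred_eq, update_of_ne (by simp; omega)]
      exact hs

end Unraveling

end Weights

/-! ### From sums over configurations to products of operators -/

open Function

/-- The edges of the `n × n` portion of the triangular lattice, as in `EdgeConfig`. -/
inductive Edge (n : ℕ)
  | h (i : Fin (n + 1)) (y : Fin n)
  | v (x : Fin n) (j : Fin (n + 1))
  | d (i j : Fin (n + 1))
  deriving DecidableEq, Fintype

namespace Edge

variable {n : ℕ}

/-- The line that contains an edge. -/
def line : Edge n → Line
  | h _ y => .h y
  | v x _ => .v x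
  | d i j => .d (i + j)

/-- The sum of `F` over the configurations whose edges that are not free are occupied as the
lines that contain them. -/
noncomputable def freeSum (free : Edge n → Prop) (F : (Edge n → Bool) → ℂ) (s : State) : ℂ :=
  open scoped Classical in
  ∑ c : Edge n → Bool with ∀ e, ¬ free e → c e = s e.line, F c

/-- Freeing `f` means summing over its value `b`. Updating the state also gives the value `b` to the
other edges of the same line that are not free, such as those already passed; `hF` says that `F`
does not see them. -/
theorem freeSum_insert {free free' : Edge n → Prop} {f : Edge n} (hf : ¬ free f)
    (hfree : ∀ e, free' e ↔ free e ∨ e = f) {F : (Edge n → Bool) → ℂ}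
    (hF : ∀ c c' : Edge n → Bool, (∀ e, free' e ∨ e.line ≠ f.line → c e = c' e) → F c = F c')
    (s : State) : freeSum free' F s = ∑ b, freeSum free F (update s f.line b) := by
  classical
  unfold freeSum
  rw [← Finset.sum_fiberwise _ (fun c : Edge n → Bool => c f)]
  refine Finset.sum_congr rfl fun b _ => ?_
  refine Finset.sum_bij' (fun c _ e => if free e then c e else update s f.line b e.line)
    (fun c _ e => if free' e then c e else s e.line) ?_ ?_ ?_ ?_ ?_
  · intro c _
    simp +contextual
  · intro c hc
    simp only [Finset.mem_filter, Finset.mem_univ, true_and] at hc ⊢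
    refine ⟨fun e he => by simp [he], ?_⟩
    rw [if_pos ((hfree f).2 (Or.inr rfl)), hc f hf, update_self]
  · intro c hc
    simp only [Finset.mem_filter, Finset.mem_univ, true_and] at hc
    funext e
    dsimp only
    split_ifs with h₁ h₂
    · rfl
    · obtain rfl : e = f := ((hfree e).1 h₁).resolve_left h₂
      rw [update_self, hc.2]
    · exact (hc.1 e h₁).symm
  · intro c hc
    simp only [Finset.mem_filter, Finset.mem_univ, true_and] at hc
    funext e
    dsimp only
    split_ifs with h₁ h₂
    · rfl
    · exact absurd ((hfree e).2 (Or.inl h₁)) h₂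
    · exact (hc e h₁).symm
  · intro c hc
    simp only [Finset.mem_filter, Finset.mem_univ, true_and] at hc
    refine hF _ _ fun e he => ?_
    split_ifs with h₁
    · rfl
    · by_cases h₂ : free' e
      · obtain rfl : e = f := ((hfree e).1 h₂).resolve_left h₁
        rw [update_self, hc.2]
      · rw [update_of_ne (he.resolve_left h₂), hc.1 e h₂]

theorem freeSum_congr {free : Edge n → Prop} {F G : (Edge n → Bool) → ℂ} {s : State}
    (h : ∀ c : Edge n → Bool, (∀ e, ¬ free e → c e = s e.line) → F c = G c) :
    freeSum free F s = freeSum free G s := by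
  classical
  exact Finset.sum_congr rfl fun c hc => h c (Finset.mem_filter.1 hc).2

theorem freeSum_mul {free : Edge n → Prop} (r : ℂ) (F : (Edge n → Bool) → ℂ) (s : State) :
    freeSum free (fun c => r * F c) s = r * freeSum free F s := by
  classical
  exact (Finset.mul_sum _ _ _).symm

end Edge

open Edge

section PartialSums

variable {n : ℕ}

/-- The node `(x, y)` belongs to the row `r` and has an abscissa at least `x₀`, or it belongs to
a row above. -/
def After (r x₀ x y : ℕ) : Prop := r < x + y ∨ r = x + y ∧ x₀ ≤ x

instance (r x₀ x y : ℕ) : Decidable (After r x₀ x y) := inferInstanceAs (Decidable (_ ∨ _))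

/-- The edges that leave the nodes after `(x₀, r - x₀)` towards the upper right. -/
def FreeEdge (r x₀ : ℕ) : Edge n → Prop
  | .h i y => 0 < i.val ∧ After r x₀ (i.val - 1) y.val
  | .v x j => 0 < j.val ∧ After r x₀ x.val (j.val - 1)
  | .d i j => 0 < i.val ∧ j.val < n ∧ After r x₀ (i.val - 1) j.val

/-- The weight of a node. -/
def nodeValue (W : ℕ → Bool → Bool → Bool → Bool → Bool → Bool → ℂ) (c : Edge n → Bool)
    (u : Fin n × Fin n) : ℂ :=
  W u.1 (c (.h u.1.castSucc u.2)) (c (.v u.1 u.2.castSucc)) (c (.d u.1.castSucc u.2.succ))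
    (c (.h u.1.succ u.2)) (c (.v u.1 u.2.succ)) (c (.d u.1.succ u.2.castSucc))

/-- The boundary conditions at the upper right ends of the horizontal and vertical lines and at
the lower right ends of the diagonals. -/
structure FinalBoundary (δ : ℕ → Bool) (c : Edge n → Bool) : Prop where
  right : ∀ y, c (.h (Fin.last n) y) = false
  top : ∀ x, c (.v x (Fin.last n)) = false
  right_diag : ∀ j : Fin (n + 1), c (.d (Fin.last n) j) = δ (n + j)
  bottom_diag : ∀ i : Fin (n + 1), c (.d i 0) = δ i

theorem FinalBoundary.congr {δ : ℕ → Bool} {c c' : Edge n → Bool} (hc : FinalBoundary δ c)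
    (h : ∀ y, c (.h (Fin.last n) y) = c' (.h (Fin.last n) y))
    (v : ∀ x, c (.v x (Fin.last n)) = c' (.v x (Fin.last n)))
    (d : ∀ j, c (.d (Fin.last n) j) = c' (.d (Fin.last n) j))
    (d' : ∀ i, c (.d i 0) = c' (.d i 0)) : FinalBoundary δ c' :=
  ⟨fun y => h y ▸ hc.right y, fun x => v x ▸ hc.top x, fun j => d j ▸ hc.right_diag j,
    fun i => d' i ▸ hc.bottom_diag i⟩

variable (W : ℕ → Bool → Bool → Bool → Bool → Bool → Bool → ℂ) (δ : ℕ → Bool)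

open scoped Classical in
/-- The product of the weights of the nodes after `(x₀, r - x₀)`, if the boundary conditions
hold. -/
noncomputable def partialWeight (r x₀ : ℕ) (c : Edge n → Bool) : ℂ :=
  (∏ u : Fin n × Fin n with After r x₀ u.1 u.2, nodeValue W c u)
    * if FinalBoundary δ c then 1 else 0

variable (n)

/-- The partition function of the nodes after `(x₀, r - x₀)`, as a function of the occupation of
the lines that reach them. -/
noncomputable def partialSum (r x₀ : ℕ) : State → ℂ :=
  freeSum (n := n) (FreeEdge r x₀) (partialWeight W δ r x₀)

variable {n W δ}

theorem partialSum_congr {r x₀ r' x₀' : ℕ}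
    (h : ∀ x < n, ∀ y < n, After r x₀ x y ↔ After r' x₀' x y) :
    partialSum n W δ r x₀ = partialSum n W δ r' x₀' := by
  have e : FreeEdge (n := n) r x₀ = FreeEdge r' x₀' := by
    funext e
    cases e with
    | h i y =>
      simp only [FreeEdge, eq_iff_iff]
      exact and_congr_right fun hi => h _ (by omega) _ y.isLt
    | v x j =>
      simp only [FreeEdge, eq_iff_iff]
      exact and_congr_right fun hi => h _ x.isLt _ (by omega)
    | d i j =>
      simp only [FreeEdge, eq_iff_iff]
      exact and_congr_right fun hi => and_congr_right fun hj => h _ (by omega) _ hj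
  unfold partialSum
  rw [e]
  congr 1
  funext c
  unfold partialWeight
  congr 1
  refine Finset.prod_congr (Finset.filter_congr fun u _ => h _ u.1.isLt _ u.2.isLt) fun _ _ => rfl

-- The remaining nodes and the final boundary meet the three lines through `(x₀, y₀)` only beyond
-- that node. This is the independence that `freeSum_insert` requires.
open scoped Classical in
theorem partialWeight_congr {r x₀ y₀ : ℕ} (hr : r = x₀ + y₀) (hx : x₀ < n) (hy : y₀ < n)
    {c c' : Edge n → Bool}
    (hc : ∀ e : Edge n, FreeEdge r x₀ e ∨ e.line ≠ .h y₀ ∧ e.line ≠ .v x₀ ∧ e.line ≠ .d (r + 1) →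
      c e = c' e) :
    partialWeight W δ r (x₀ + 1) c = partialWeight W δ r (x₀ + 1) c' := by
  unfold partialWeight
  have hh : ∀ (i : Fin (n + 1)) (y : Fin n), (0 < i.val ∧ After r x₀ (i.val - 1) y.val) ∨
      y.val ≠ y₀ → c (.h i y) = c' (.h i y) := by
    intro i y h
    exact hc _ (h.imp id fun h => ⟨by simpa [line] using h, by simp [line], by simp [line]⟩)
  have hv : ∀ (x : Fin n) (j : Fin (n + 1)), (0 < j.val ∧ After r x₀ x.val (j.val - 1)) ∨
      x.val ≠ x₀ → c (.v x j) = c' (.v x j) := by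
    intro i y h
    exact hc _ (h.imp id fun h => ⟨by simp [line], by simpa [line] using h, by simp [line]⟩)
  have hd : ∀ (i j : Fin (n + 1)), (0 < i.val ∧ j.val < n ∧ After r x₀ (i.val - 1) j.val) ∨
      i.val + j.val ≠ r + 1 → c (.d i j) = c' (.d i j) := by
    intro i y h
    exact hc _ (h.imp id fun h => ⟨by simp [line], by simp [line], by simpa [line] using h⟩)
  congr 1
  · refine Finset.prod_congr rfl fun u hu => ?_
    obtain ⟨x, y⟩ := u
    have hx' := x.isLt
    have hy' := y.isLt
    replace hu : After r (x₀ + 1) x y := (Finset.mem_filter.1 hu).2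
    unfold After at hu
    unfold nodeValue
    rw [hh x.castSucc y, hv x y.castSucc, hd x.castSucc y.succ, hh x.succ y, hv x y.succ,
      hd x.succ y.castSucc] <;> simp [After] <;> omega
  · have e : ∀ c c' : Edge n → Bool, (∀ y, c (.h (Fin.last n) y) = c' (.h (Fin.last n) y)) →
        (∀ x, c (.v x (Fin.last n)) = c' (.v x (Fin.last n))) →
        (∀ j, c (.d (Fin.last n) j) = c' (.d (Fin.last n) j)) →
        (∀ i, c (.d i 0) = c' (.d i 0)) → (FinalBoundary δ c ↔ FinalBoundary δ c') :=
      fun c c' h v d d' => ⟨fun hc => hc.congr h v d d', fun hc => hc.congr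
        (fun y => (h y).symm) (fun x => (v x).symm) (fun y => (d y).symm) (fun x => (d' x).symm)⟩
    refine if_congr (e _ _ ?_ ?_ ?_ ?_) rfl rfl
    · intro y
      have := y.isLt
      exact hh _ _ (by simp [After]; omega)
    · intro x
      have := x.isLt
      exact hv _ _ (by simp [After]; omega)
    · intro j
      have := j.isLt
      exact hd _ _ (by simp [After]; omega)
    · intro i
      have := i.isLt
      have h₀ : ((0 : Fin (n + 1)) : ℕ) = 0 := rfl
      exact hd _ _ (by simp only [After, h₀]; omega)

/-- The contribution of the first node. -/
theorem partialSum_eq_nodeOp {r x₀ y₀ : ℕ} (hr : r = x₀ + y₀) (hx : x₀ < n) (hy : y₀ < n) :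
    partialSum n W δ r x₀
      = nodeOp (.h y₀) (.v x₀) (.d (x₀ + y₀ + 1)) (W x₀) (partialSum n W δ r (x₀ + 1)) := by
  funext s
  obtain ⟨x, rfl⟩ : ∃ x : Fin n, x₀ = x.val := ⟨⟨x₀, hx⟩, rfl⟩
  obtain ⟨y, rfl⟩ : ∃ y : Fin n, y₀ = y.val := ⟨⟨y₀, hy⟩, rfl⟩
  let E : Edge n := .h x.succ y
  let N : Edge n := .v x y.succ
  let O : Edge n := .d x.succ y.castSucc
  have lE : E.line = .h y := rfl
  have lN : N.line = .v x := rfl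
  have lO : O.line = .d (x + y + 1) := by simp [O, line]; omega
  have hfree : ∀ e : Edge n, FreeEdge r x e ↔ FreeEdge r (x + 1) e ∨ e = O ∨ e = N ∨ e = E := by
    intro e
    cases e with
    | h i z =>
      simp only [FreeEdge, After, E, N, O, Edge.h.injEq, reduceCtorEq, false_or, Fin.ext_iff,
        Fin.val_succ]
      omega
    | v z j =>
      simp only [FreeEdge, After, E, N, O, Edge.v.injEq, reduceCtorEq, false_or, or_false,
        Fin.ext_iff, Fin.val_succ]
      omega
    | d i j =>
      simp only [FreeEdge, After, E, N, O, Edge.d.injEq, reduceCtorEq, or_false,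
        Fin.ext_iff, Fin.val_succ, Fin.val_castSucc]
      omega
  have hE : ¬ FreeEdge r (x + 1) E := by simp [FreeEdge, After, E]; omega
  have hN : ¬ FreeEdge r (x + 1) N := by simp [FreeEdge, After, N]; omega
  have hO : ¬ FreeEdge r (x + 1) O := by simp [FreeEdge, After, O]; omega
  have hprod : ∀ c : Edge n → Bool, partialWeight W δ r x c
      = nodeValue W c (x, y) * partialWeight W δ r (x + 1) c := by
    intro c
    unfold partialWeight
    rw [← mul_assoc]
    congr 1
    have : (Finset.univ.filter fun u : Fin n × Fin n => After r x u.1 u.2)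
        = insert (x, y) (Finset.univ.filter fun u : Fin n × Fin n => After r (x + 1) u.1 u.2) := by
      ext ⟨a, b⟩
      rw [Finset.mem_filter, Finset.mem_insert, Finset.mem_filter]
      simp only [Finset.mem_univ, true_and, Prod.mk.injEq, Fin.ext_iff]
      unfold After
      omega
    rw [this, Finset.prod_insert (by simp [After]; omega)]
  -- The incoming edges are evaluated in `s` before any outgoing edge is summed, since afterwards
  -- the state of their lines is the updated one.
  have step : partialSum n W δ r x s = freeSum (FreeEdge r x) (fun c =>
      W x (s (.h y)) (s (.v x)) (s (.d (x + y + 1))) (c E) (c N) (c O)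
        * partialWeight W δ r (x + 1) c) s := by
    refine freeSum_congr fun c hc => ?_
    rw [hprod, nodeValue, hc (.h x.castSucc y), hc (.v x y.castSucc), hc (.d x.castSucc y.succ)]
    · simp only [line, Fin.val_castSucc, Fin.val_succ, add_assoc]
      rfl
    all_goals simp [FreeEdge, After]; omega
  have dep : ∀ c c' : Edge n → Bool,
      (∀ e : Edge n, FreeEdge r x e ∨ e.line ≠ .h y ∧ e.line ≠ .v x ∧ e.line ≠ .d (x + y + 1) →
        c e = c' e) →
      W x (s (.h y)) (s (.v x)) (s (.d (x + y + 1))) (c E) (c N) (c O)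
        * partialWeight W δ r (x + 1) c
      = W x (s (.h y)) (s (.v x)) (s (.d (x + y + 1))) (c' E) (c' N) (c' O)
        * partialWeight W δ r (x + 1) c' := by
    intro c c' h
    rw [h E (.inl ((hfree E).2 (by simp))), h N (.inl ((hfree N).2 (by simp))),
      h O (.inl ((hfree O).2 (by simp))),
      partialWeight_congr hr hx hy (by rw [hr]; rw [hr] at h; exact h)]
  rw [step, nodeOp_apply,
    freeSum_insert (free := fun e => FreeEdge r (x + 1) e ∨ e = O ∨ e = N) (f := E)
      (by rintro (h | h | h); exacts [hE h, by simp [E, O] at h, by simp [E, N] at h])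
      (fun e => by rw [hfree]; tauto)]
  · refine Finset.sum_congr rfl fun p _ => ?_
    rw [freeSum_insert (free := fun e => FreeEdge r (x + 1) e ∨ e = O) (f := N)
      (by rintro (h | h); exacts [hN h, by simp [N, O] at h])
      (fun e => by tauto)]
    · refine Finset.sum_congr rfl fun q _ => ?_
      rw [freeSum_insert (free := fun e => FreeEdge r (x + 1) e) (f := O) hO (fun e => Iff.rfl)]
      · refine Finset.sum_congr rfl fun t _ => ?_
        rw [partialSum, ← freeSum_mul, lE, lN, lO]
        refine freeSum_congr fun c hc => ?_
        rw [hc E hE, hc N hN, hc O hO, lE, lN, lO]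
        simp
      · intro c c' h
        refine dep c c' fun e he => h e ?_
        rcases he with he | he
        · rcases (hfree e).1 he with h | rfl | rfl | rfl
          · exact .inl (.inl h)
          · exact .inl (.inr rfl)
          · exact .inr (by simp [lN, lO])
          · exact .inr (by simp [lE, lO])
        · exact .inr (lO ▸ he.2.2)
    · intro c c' h
      refine dep c c' fun e he => h e ?_
      rcases he with he | he
      · rcases (hfree e).1 he with h | rfl | rfl | rfl
        · exact .inl (.inl h)
        · exact .inl (.inr (.inl rfl))
        · exact .inl (by simp)
        · exact .inr (by simp [lE, lN])
      · exact .inr (lN ▸ he.2.1)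
  · intro c c' h
    refine dep c c' fun e he => h e ?_
    rcases he with he | he
    · exact .inl he
    · exact .inr (lE ▸ he.1)

theorem partialSum_eq_rangeProd {r x₀ p : ℕ} (hp : x₀ + p ≤ n) (hp' : x₀ + p ≤ r + 1)
    (hr : r < n + x₀) :
    partialSum n W δ r x₀
      = rangeProd (fun i => nodeOp (.h (r - x₀ - i)) (.v (x₀ + i)) (.d (x₀ + i + (r - x₀ - i) + 1))
          (W (x₀ + i))) p (partialSum n W δ r (x₀ + p)) := by
  induction p with
  | zero => simp
  | succ p ih =>
    rw [ih (by omega) (by omega), rangeProd_succ, Module.End.mul_apply,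
      partialSum_eq_nodeOp (x₀ := x₀ + p) (y₀ := r - x₀ - p) (by omega) (by omega) (by omega),
      add_assoc x₀ p 1]

/-- The row of `p` nodes is `x + y = p - 1`. The truncated subtraction suits the empty row: for `m =
0` and `m = 1` no node has been passed. -/
theorem partialSum_eq_lowerProd {m : ℕ} (hm : m ≤ n) :
    partialSum n W δ 0 0
      = lowerProd (fun x y => nodeOp (.h y) (.v x) (.d (x + y + 1)) (W x)) m
          (partialSum n W δ (m - 1) 0) := by
  induction m with
  | zero => simp [lowerProd]
  | succ m ih =>
    rw [ih (by omega), lowerProd, lowerProd, rangeProd_succ, Module.End.mul_apply]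
    congr 1
    rcases Nat.eq_zero_or_pos m with rfl | hm'
    · simp [rowProd]
    · rw [partialSum_eq_rangeProd (x₀ := 0) (p := m) (by omega) (by omega) (by omega), rowProd]
      simp only [Nat.sub_zero, Nat.zero_add, Nat.add_sub_cancel]
      congr 1
      exact partialSum_congr fun x _ y _ => by unfold After; omega

theorem partialSum_eq_upperProd {o p : ℕ} (h : o + p = n) :
    partialSum n W δ (n - 1 + o) 0
      = upperProd (fun x y => nodeOp (.h y) (.v x) (.d (x + y + 1)) (W x)) o p
          (partialSum n W δ (2 * n - 1) 0) := by
  induction p generalizing o with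
  | zero =>
    simp only [upperProd, Module.End.one_apply]
    rw [show n - 1 + o = 2 * n - 1 by omega]
  | succ p ih =>
    rw [upperProd, Module.End.mul_apply, ← ih (by omega),
      partialSum_congr (r' := n - 1 + o) (x₀' := o) fun x _ y _ => by unfold After; omega,
      partialSum_eq_rangeProd (p := p + 1) (by omega) (by omega) (by omega), rowProd,
      show n - 1 + o - o = o + (p + 1) - 1 by omega]
    congr 1
    exact partialSum_congr fun x _ y _ => by unfold After; omega

open scoped Classical in
/-- The indicator function of the final states. -/
noncomputable def finalVec (n : ℕ) (δ : ℕ → Bool) (s : State) : ℂ :=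
  if (∀ y < n, s (.h y) = false) ∧ (∀ x < n, s (.v x) = false) ∧ ∀ k ≤ 2 * n, s (.d k) = δ k
  then 1 else 0

theorem partialSum_last : partialSum n W δ (2 * n - 1) 0 = finalVec n δ := by
  classical
  funext s
  have hA : ∀ x < n, ∀ y < n, ¬ After (2 * n - 1) 0 x y := by
    intro x hx y hy
    unfold After
    omega
  have hfree : ∀ e : Edge n, ¬ FreeEdge (2 * n - 1) 0 e := by
    intro e
    cases e with
    | h i y => exact fun h => hA (i - 1) (by have := h.1; omega) y y.isLt h.2
    | v x j => exact fun h => hA x x.isLt (j - 1) (by have := h.1; omega) h.2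
    | d i j => exact fun h => hA (i - 1) (by have := h.1; omega) j h.2.1 h.2.2
  have hset : (Finset.univ.filter fun c : Edge n → Bool =>
      ∀ e, ¬ FreeEdge (2 * n - 1) 0 e → c e = s e.line) = {fun e => s e.line} := by
    ext c
    simp [hfree, funext_iff]
  unfold partialSum freeSum
  rw [hset, Finset.sum_singleton, partialWeight, Finset.prod_eq_one, one_mul, finalVec]
  -- The range `k ≤ 2 * n` includes `k = 0` and `k = 2 * n`, which carry no node, so that the values
  -- of `d` at the two non-edges are fixed as well.
  · refine if_congr ⟨fun h => ⟨fun y hy => h.right ⟨y, hy⟩, fun x hx => h.top ⟨x, hx⟩,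
      fun k hk => ?_⟩, fun h => ⟨fun y => h.1 y y.isLt, fun x => h.2.1 x x.isLt,
        fun j => h.2.2 (n + j) (by have := j.isLt; omega), fun i => by
        simpa [line] using h.2.2 i (by have := i.isLt; omega)⟩⟩ rfl rfl
    rcases Nat.lt_or_ge n k with hk' | hk'
    · have := h.right_diag ⟨k - n, by omega⟩
      simpa [line, show n + (k - n) = k by omega] using this
    · simpa [line] using h.bottom_diag ⟨k, by omega⟩
  · intro u hu
    exact absurd (Finset.mem_filter.1 hu).2 (hA _ u.1.isLt _ u.2.isLt)

/-- The state of the lines at their lower left, respectively upper left, ends. -/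
def initialState (δ : ℕ → Bool) : State
  | .h _ => true
  | .v _ => true
  | .d k => δ k

/-- The domain wall boundary conditions, where `δ k` is the occupation of the first and last edges
of the diagonal `k`. -/
structure Boundary (δ : ℕ → Bool) (c : EdgeConfig n) : Prop where
  square : c.SquareDWBC
  diag : ∀ i j, i = 0 ∨ i = Fin.last n ∨ j = 0 ∨ j = Fin.last n → c.d i j = δ (i + j)

/-- Edge configurations as functions on the edges. -/
def edgeEquiv (n : ℕ) : EdgeConfig n ≃ (Edge n → Bool) where
  toFun c
    | .h i y => c.h i y
    | .v x j => c.v x j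
    | .d i j => c.d i j
  invFun c := ⟨fun i y => c (.h i y), fun x j => c (.v x j), fun i j => c (.d i j)⟩
  left_inv _ := rfl
  right_inv c := by
    funext e
    cases e <;> rfl

/-- The weight of a node as a function of its environment. -/
def Vertex.value (W : Bool → Bool → Bool → Bool → Bool → Bool → ℂ) (u : Vertex) : ℂ :=
  W (u.inc .hor) (u.out .vert) (u.inc .diag) (u.out .hor) (u.inc .vert) (u.out .diag)

open scoped Classical in
/-- The partition function as a product of operators. -/
theorem sum_boundary_eq (W : ℕ → Bool → Bool → Bool → Bool → Bool → Bool → ℂ) (δ : ℕ → Bool) :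
    ∑ c : EdgeConfig n with Boundary δ c, ∏ x, ∏ y, (c.vertex x y).value (W x)
      = lowerProd (fun x y => nodeOp (.h y) (.v x) (.d (x + y + 1)) (W x)) n
          (upperProd (fun x y => nodeOp (.h y) (.v x) (.d (x + y + 1)) (W x)) 0 n (finalVec n δ))
          (initialState δ) := by
  rw [← partialSum_last (W := W), ← partialSum_eq_upperProd (by omega), add_zero,
    ← partialSum_eq_lowerProd le_rfl, partialSum, freeSum, Finset.sum_filter, Finset.sum_filter]
  refine Fintype.sum_equiv (edgeEquiv n) _ _ fun c => ?_
  have hp : ∏ u : Fin n × Fin n with After 0 0 u.1 u.2, nodeValue W (edgeEquiv n c) u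
      = ∏ x, ∏ y, (c.vertex x y).value (W x) := by
    have hA : ∀ u ∈ (Finset.univ : Finset (Fin n × Fin n)), After 0 0 u.1 u.2 := fun u _ => by
      unfold After
      omega
    rw [Finset.filter_true_of_mem hA, Fintype.prod_prod_type]
    rfl
  rw [partialWeight, hp, mul_ite, mul_one, mul_zero, ← ite_and]
  refine if_congr ⟨fun h => ⟨fun e he => ?_, ⟨h.square.right, h.square.top, fun j => ?_,
    fun i => ?_⟩⟩, fun h => ⟨⟨fun y => ?_, h.2.right, fun x => ?_, h.2.top⟩, ?_⟩⟩ rfl rfl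
  · cases e with
    | h i y =>
      obtain rfl : i = 0 := by
        simp only [FreeEdge, After, Fin.ext_iff, Fin.val_zero] at he ⊢
        omega
      exact h.square.left y
    | v x j =>
      obtain rfl : j = 0 := by
        simp only [FreeEdge, After, Fin.ext_iff, Fin.val_zero] at he ⊢
        omega
      exact h.square.bottom x
    | d i j =>
      refine h.diag i j ?_
      simp only [FreeEdge, After, Fin.ext_iff, Fin.val_zero, Fin.val_last] at he ⊢
      omega
  · exact h.diag _ _ (by simp)
  · exact (h.diag i 0 (by simp)).trans (by simp)
  · exact h.1 (.h 0 y) (by simp [FreeEdge])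
  · exact h.1 (.v x 0) (by simp [FreeEdge])
  · rintro i j (rfl | rfl | rfl | rfl)
    · exact h.1 (.d 0 j) (by simp [FreeEdge])
    · exact h.2.right_diag j
    · exact (h.2.bottom_diag i).trans (by simp)
    · exact h.1 (.d i (Fin.last n)) (by simp [FreeEdge])

end PartialSums

/-! ### The uppermost path and the last column -/

namespace EdgeConfig

variable {n : ℕ}

/-- The ice rule and the boundary conditions shared by the 20V and the 6V models. -/
structure IsDomainWall (c : EdgeConfig n) : Prop where
  ice : ∀ x y, (c.vertex x y).Ice
  square : c.SquareDWBC
  right_diag : ∀ j, c.d (Fin.last n) j = false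
  top_diag : ∀ i, c.d i (Fin.last n) = false

theorem IsTwentyV.isDomainWall {c : EdgeConfig n} (hc : c.IsTwentyV) : c.IsDomainWall :=
  ⟨hc.ice, hc.square, hc.right_diag, hc.top_diag⟩

theorem IsSixV.isDomainWall {c : EdgeConfig n} (hc : c.IsSixV) : c.IsDomainWall :=
  ⟨hc.ice, hc.square, hc.no_diag _, fun i => hc.no_diag i _⟩

namespace IsDomainWall

variable {c : EdgeConfig n} (hc : c.IsDomainWall)
include hc

theorem ice_eq (x y : Fin n) :
    (c.h x.castSucc y).toNat + (c.d x.castSucc y.succ).toNat + (c.v x y.succ).toNat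
      = (c.h x.succ y).toNat + (c.d x.succ y.castSucc).toNat + (c.v x y.castSucc).toNat :=
  hc.ice x y

/-- If no path enters a column at height at least `Y`, then no path visits it there. -/
theorem empty_column (x : Fin n) (Y : ℕ) (hh : ∀ y : Fin n, Y ≤ y → c.h x.castSucc y = false)
    (hd : ∀ j : Fin (n + 1), Y < j → c.d x.castSucc j = false) :
    (∀ j : Fin (n + 1), Y ≤ j → c.v x j = false) ∧
      (∀ y : Fin n, Y ≤ y → c.h x.succ y = false) ∧
      ∀ j : Fin (n + 1), Y ≤ j → c.d x.succ j = false := by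
  have step : ∀ y : Fin n, Y ≤ y → c.v x y.succ = false →
      c.v x y.castSucc = false ∧ c.h x.succ y = false ∧ c.d x.succ y.castSucc = false := by
    intro y hy hv
    have e := hc.ice_eq x y
    rw [hh y hy, hd y.succ (by simp; omega), hv] at e
    simp only [Bool.toNat_false] at e
    refine ⟨?_, ?_, ?_⟩ <;> rw [← Bool.toNat_eq_zero] <;> omega
  have hv : ∀ j : Fin (n + 1), Y ≤ j → c.v x j = false := by
    intro j
    induction j using Fin.reverseInduction with
    | last => exact fun _ => hc.square.top x
    | cast y ih => exact fun hy => (step y hy (ih (by simp at hy ⊢; omega))).1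
  refine ⟨hv, fun y hy => (step y hy (hv _ (by simp; omega))).2.1, fun j => ?_⟩
  induction j using Fin.lastCases with
  | last => exact fun _ => hc.top_diag _
  | cast y => exact fun hy => (step y hy (hv _ (by simp at hy ⊢; omega))).2.2

/-- The uppermost path reaches the last column. -/
theorem exists_hitsRight_of_enters (m : ℕ) (x y : Fin n) (s : Step) (hm : n - x + y ≤ m)
    (h : c.UppermostEnters x y s) (hs : (c.vertex x y).inc s = true)
    (hs' : (c.vertex x y).incAbove s = 0) (hlast : x.val + 1 = n → s ≠ .vert)
    (hh : ∀ y' : Fin n, y < y' → c.h x.succ y' = false)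
    (hd : ∀ j : Fin (n + 1), y.val < j → c.d x.succ j = false) :
    ∃ y s, c.HitsRight y s := by
  -- Each step decreases `n - x + y`. The invariant is that nothing leaves the column of `x` above
  -- the path and that `s` is the topmost incoming edge, so `Linked` continues the path by the
  -- topmost outgoing edge.
  induction m generalizing x y s with
  | zero => have := x.isLt; omega
  | succ m ih =>
    by_cases hx : x.val + 1 = n
    · exact ⟨y, s, hlast hx, x, hx, h⟩
    obtain ⟨x', hx'⟩ : ∃ x' : Fin n, x'.val = x.val + 1 := ⟨⟨x + 1, by omega⟩, rfl⟩
    have hxx : x'.castSucc = x.succ := Fin.ext (by simp [hx'])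
    cases ho : c.h x.succ y with
    | true =>
      have col := hc.empty_column x' (y + 1) (fun y' hy => hxx ▸ hh y' hy)
        (fun j hj => hxx ▸ hd j (by omega))
      refine ih x' y .hor (by omega) (.next x y s .hor x' y h ⟨hs, ho, hs'⟩ ⟨hx', rfl⟩) ?_ ?_
        (fun _ => by simp) (fun y' hy => col.2.1 y' hy) (fun j hj => col.2.2 j hj)
      · simpa [vertex, hxx] using ho
      · simp [Vertex.incAbove, vertex, hxx, hd y.succ (by simp), col.1 y.succ (by simp)]
    | false =>
      have col := hc.empty_column x' y (fun y' hy => by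
          rcases eq_or_lt_of_le hy with e | hy
          · rw [hxx, ← Fin.ext e, ho]
          · exact hxx ▸ hh y' hy)
        (fun j hj => hxx ▸ hd j hj)
      -- At height `0` the next column would carry no path at all, whereas its bottom edge is
      -- occupied.
      have hy : 0 < y.val := by
        by_contra hy
        have := col.1 0 (by simp; omega)
        rw [hc.square.bottom x'] at this
        exact absurd this (by simp)
      obtain ⟨y', hy'⟩ : ∃ y' : Fin n, y'.val + 1 = y.val := ⟨⟨y - 1, by omega⟩, by simp; omega⟩
      have hyy : y'.succ = y.castSucc := Fin.ext (by simp [hy'])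
      cases ho' : c.d x.succ y.castSucc with
      | true =>
        refine ih x' y' .diag (by omega) (.next x y s .diag x' y' h ⟨hs, ho', ?_⟩ ⟨hx', hy'⟩) ?_ ?_
          (fun _ => by simp) (fun z hz => col.2.1 z (by omega)) (fun j hj => col.2.2 j (by omega))
        · simpa [Vertex.outAbove, vertex, ho] using hs'
        · simpa [vertex, hxx, hyy] using ho'
        · simp [Vertex.incAbove, vertex, hyy, col.1 y.castSucc (by simp)]
      | false =>
        have ho'' : c.v x y.castSucc = true := by
          have e := hc.ice_eq x y
          rw [ho, ho'] at e
          have : 1 ≤ (c.h x.castSucc y).toNat + (c.d x.castSucc y.succ).toNat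
              + (c.v x y.succ).toNat := by
            cases s <;> simp only [vertex] at hs <;> rw [hs, Bool.toNat_true] <;> omega
          rw [← Bool.toNat_eq_one]
          have := Bool.toNat_le (c.v x y.castSucc)
          simp only [Bool.toNat_false] at e
          omega
        refine ih x y' .vert (by omega) (.next x y s .vert x y' h ⟨hs, ho'', ?_⟩ ⟨rfl, hy'⟩) ?_ rfl
          (fun h => absurd h hx) (fun z hz => ?_) (fun j hj => ?_)
        · simpa [Vertex.outAbove, vertex, ho, ho'] using hs'
        · simpa [vertex, hyy] using ho''
        · rcases eq_or_lt_of_le (show y.val ≤ z by have : y'.val < z := hz; omega) with e | hz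
          · rw [← Fin.ext e, ho]
          · exact hh z hz
        · rcases eq_or_lt_of_le (show y.val ≤ j by omega) with e | hj
          · rw [← show y.castSucc = j from Fin.ext e, ho']
          · exact hd j hj

theorem exists_hitsRight (hn : 0 < n) : ∃ y s, c.HitsRight y s := by
  have e : (⟨n - 1, by omega⟩ : Fin n).succ = Fin.last n := Fin.ext (by simp; omega)
  have e₀ : (⟨0, hn⟩ : Fin n).castSucc = 0 := rfl
  refine hc.exists_hitsRight_of_enters _ ⟨0, hn⟩ ⟨n - 1, by omega⟩ .hor le_rfl
    (.start _ _ rfl (by simp; omega) (hc.square.left _)) (hc.square.left _) ?_ (fun _ => by simp)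
    (fun y hy => ?_) (fun j hj => ?_)
  · simp [Vertex.incAbove, vertex, e, hc.square.top, hc.top_diag]
  · have := y.isLt
    simp [Fin.lt_def] at hy
    omega
  · rw [show j = Fin.last n from Fin.ext (by simp at hj ⊢; omega)]
    exact hc.top_diag _

end IsDomainWall

theorem UppermostEnters.inc {c : EdgeConfig n} {x y : Fin n} {s : Step}
    (h : c.UppermostEnters x y s) : (c.vertex x y).inc s = true := by
  cases h with
  | start _ _ _ _ h => exact h
  | next x₀ y₀ s₀ _ _ _ _ hl h =>
    have ho := hl.2.1
    cases s with
    | hor =>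
      obtain ⟨hx, rfl⟩ := h
      rw [← ho]
      exact congrArg (fun i => c.h i _) (Fin.ext hx)
    | diag =>
      obtain ⟨hx, hy⟩ := h
      rw [← ho]
      exact congrArg₂ c.d (Fin.ext hx) (Fin.ext hy)
    | vert =>
      obtain ⟨rfl, hy⟩ := h
      rw [← ho]
      exact congrArg (c.v _) (Fin.ext hy)

namespace IsDomainWall

variable {c : EdgeConfig n} (hc : c.IsDomainWall)
include hc

section LastColumn

variable {x : Fin n} (hx : x.val + 1 = n)
include hx

theorem last_column_ice (y : Fin n) :
    (c.h x.castSucc y).toNat + (c.d x.castSucc y.succ).toNat + (c.v x y.succ).toNat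
      = (c.v x y.castSucc).toNat := by
  have e := hc.ice_eq x y
  have hl : x.succ = Fin.last n := Fin.ext (by simpa using hx)
  rw [hl, hc.square.right, hc.right_diag] at e
  simpa using e

/-- Nothing leaves the last column to the right, so an occupied vertical edge forces all those below
it. -/
theorem last_column_below {y : Fin n} (hy : c.v x y.castSucc = true) {j : Fin (n + 1)}
    (hj : j.val ≤ y) : c.v x j = true := by
  obtain ⟨m, hm⟩ : ∃ m, j.val + m = y := ⟨y - j, by omega⟩
  induction m generalizing j with
  | zero =>
    rw [show j = y.castSucc from Fin.ext (by simpa using hm)]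
    exact hy
  | succ m ih =>
    obtain ⟨z, rfl⟩ : ∃ z : Fin n, z.castSucc = j := ⟨⟨j, by omega⟩, rfl⟩
    have e := hc.last_column_ice hx z
    rw [ih (j := z.succ) (by simp at hm ⊢; omega) (by simp at hm ⊢; omega)] at e
    rw [← Bool.toNat_eq_one]
    have := Bool.toNat_le (c.v x z.castSucc)
    simp only [Bool.toNat_true] at e
    omega

/-- The last column below a node that is entered by a step that is not vertical. -/
theorem last_column_of_lt {y : Fin n} (hv : c.v x y.castSucc = true) {z : Fin n} (hz : z < y) :
    c.h x.castSucc z = false ∧ c.d x.castSucc z.succ = false ∧ c.v x z.succ = true := by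
  have h := hc.last_column_below hx hv (j := z.succ) (by simp; omega)
  have e := hc.last_column_ice hx z
  have := Bool.toNat_le (c.v x z.castSucc)
  rw [h] at e
  simp only [Bool.toNat_true] at e
  refine ⟨?_, ?_, h⟩ <;> rw [← Bool.toNat_eq_zero] <;> omega

/-- The last column above a node that is entered by a step that is not vertical. -/
theorem last_column_of_gt {y : Fin n} (hv : c.v x y.succ = false) {z : Fin n} (hz : y < z) :
    c.h x.castSucc z = false ∧ c.d x.castSucc z.succ = false ∧ c.v x z.succ = false := by
  have h : c.v x z.castSucc = false := by
    by_contra h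
    rw [hc.last_column_below hx (by simpa using h) (j := y.succ) (by simp; omega)] at hv
    exact absurd hv (by simp)
  have e := hc.last_column_ice hx z
  rw [h] at e
  simp only [Bool.toNat_false] at e
  refine ⟨?_, ?_, ?_⟩ <;> rw [← Bool.toNat_eq_zero] <;> omega

end LastColumn

/-- The environments of the nodes of the last column in terms of the hitting point. -/
theorem last_column {x y : Fin n} (hx : x.val + 1 = n) {s : Step} (h : c.HitsRight y s)
    (z : Fin n) : c.h x.castSucc z = decide (z = y ∧ s = .hor) ∧
      c.d x.castSucc z.succ = decide (z = y ∧ s = .diag) ∧ c.v x z.succ = decide (z < y) := by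
  obtain ⟨hs, x', hx', h⟩ := h
  obtain rfl : x = x' := Fin.ext (by omega)
  have hi := h.inc
  have e := hc.last_column_ice hx y
  have := Bool.toNat_le (c.v x y.castSucc)
  have hv : c.v x y.castSucc = true ∧ c.v x y.succ = false ∧ c.h x.castSucc y = decide (s = .hor) ∧
      c.d x.castSucc y.succ = decide (s = .diag) := by
    cases s with
    | hor =>
      replace hi : c.h x.castSucc y = true := hi
      rw [hi] at e
      simp only [Bool.toNat_true] at e
      refine ⟨?_, ?_, hi, ?_⟩
      · rw [← Bool.toNat_eq_one]; omega
      · rw [← Bool.toNat_eq_zero]; omega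
      · rw [show decide (Step.hor = Step.diag) = false by simp, ← Bool.toNat_eq_zero]; omega
    | diag =>
      replace hi : c.d x.castSucc y.succ = true := hi
      rw [hi] at e
      simp only [Bool.toNat_true] at e
      refine ⟨?_, ?_, ?_, hi⟩
      · rw [← Bool.toNat_eq_one]; omega
      · rw [← Bool.toNat_eq_zero]; omega
      · rw [show decide (Step.diag = Step.hor) = false by simp, ← Bool.toNat_eq_zero]; omega
    | vert => exact absurd rfl hs
  rcases lt_trichotomy z y with hz | rfl | hz
  · have := hc.last_column_of_lt hx hv.1 hz
    simp [this, hz, hz.ne]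
  · simp [hv]
  · have := hc.last_column_of_gt hx hv.2.1 hz
    simp [this, hz.ne', hz.le]

/-- Each hitting point determines all the edges entering the last column by `last_column`; the two
descriptions are compared at `y'`. -/
theorem hitsRight_unique {y y' : Fin n} {s s' : Step} (h : c.HitsRight y s)
    (h' : c.HitsRight y' s') : y' = y ∧ s' = s := by
  obtain ⟨x, hx⟩ : ∃ x : Fin n, x.val + 1 = n :=
    ⟨⟨n - 1, by have := y.isLt; omega⟩, by have := y.isLt; simp; omega⟩
  have e := hc.last_column hx h y'
  have e' := hc.last_column hx h' y'
  have hs := h'.1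
  cases s' with
  | hor => simpa [e.1, eq_comm (a := s)] using e'.1
  | diag => simpa [e.2.1, eq_comm (a := s)] using e'.2.1
  | vert => exact absurd rfl hs

/-- Counting the steps of the last column. -/
theorem prod_last_column {x y : Fin n} (hx : x.val + 1 = n) {s : Step} (h : c.HitsRight y s)
    (τ g : ℂ) : ∏ z : Fin n, (if c.v x z.succ then τ else if c.d x.castSucc z.succ then g else 1)
      = τ ^ (y : ℕ) * if s = .diag then g else 1 := by
  have e : ∀ z : Fin n, (if c.v x z.succ then τ else if c.d x.castSucc z.succ then g else 1)
      = (if z < y then τ else 1) * if z = y then (if s = .diag then g else 1) else 1 := by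
    intro z
    obtain ⟨-, h₁, h₂⟩ := hc.last_column hx h z
    rw [h₁, h₂]
    rcases lt_trichotomy z y with hz | rfl | hz
    · simp [hz, hz.ne]
    · simp
    · simp [hz.ne', not_lt.2 hz.le]
  rw [Finset.prod_congr rfl fun z _ => e z, Finset.prod_mul_distrib, Finset.prod_ite_eq' _ y]
  simp [Finset.prod_ite, Finset.filter_gt_eq_Iio]

end IsDomainWall

end EdgeConfig

/-! ### The 20V generating function as a sum with modified weights -/

open Function

section Refined

variable {n : ℕ}

theorem prod_prod_last {x₀ : Fin n} (hx : x₀.val + 1 = n) (f A : Fin n → Fin n → ℂ) :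
    ∏ x : Fin n, ∏ y : Fin n, (if x.val + 1 = n then f x y else 1) * A x y
      = (∏ y, f x₀ y) * ∏ x, ∏ y, A x y := by
  simp only [Finset.prod_mul_distrib]
  congr 1
  rw [Finset.prod_eq_single x₀]
  · simp [hx]
  · intro x _ h
    have : x.val + 1 ≠ n := fun h' => h (Fin.ext (by omega))
    simp [this]
  · simp

open scoped Classical in
theorem sum_hit_mul_pow (K : EdgeConfig n → Prop) (H : EdgeConfig n → Fin n → Prop)
    (P : EdgeConfig n → ℂ) (τ : ℂ) :
    ∑ y : Fin n, (∑ c : EdgeConfig n with K c ∧ H c y, P c) * τ ^ (y : ℕ)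
      = ∑ c : EdgeConfig n with K c, P c * ∑ y : Fin n, if H c y then τ ^ (y : ℕ) else 0 := by
  simp only [Finset.sum_filter, Finset.sum_mul, Finset.mul_sum]
  rw [Finset.sum_comm]
  refine Finset.sum_congr rfl fun c _ => ?_
  by_cases h : K c <;> simp [h]

end Refined

section TwentyV

theorem weight20_of_not_ice {ω : Fin 7 → ℂ} {u : Vertex} (h : ¬ u.Ice) : u.weight20 ω = 0 := by
  unfold Vertex.weight20
  unfold Vertex.Ice at h
  generalize u.inc .hor = W, u.inc .diag = I, u.inc .vert = N, u.out .hor = E, u.out .diag = O,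
    u.out .vert = S at h ⊢
  cases W <;> cases I <;> cases N <;> cases E <;> cases O <;> cases S <;>
    first
    | rfl
    | exact absurd rfl h

variable {n : ℕ}

/-- The occupation of the ends of the diagonals in the boundary conditions DWBC2. -/
def diagBoundary (n k : ℕ) : Bool := decide (0 < k ∧ k < n)

/-- DWBC2 gives both ends of a diagonal the same occupation, a function of `i + j` alone; the two
non-edges fit the same formula. -/
theorem isTwentyV_iff (c : EdgeConfig n) :
    c.IsTwentyV ↔ Boundary (diagBoundary n) c ∧ ∀ x y, (c.vertex x y).Ice := by
  have h₀ : (0 : Fin (n + 1)).val = 0 := rfl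
  have hl : (Fin.last n).val = n := rfl
  constructor
  · intro h
    refine ⟨⟨h.square, ?_⟩, h.ice⟩
    have bd : ∀ i, c.d i 0 = diagBoundary n i := by
      intro i
      by_cases hi : i = 0
      · rw [hi, h.corner]; simp [diagBoundary]
      by_cases hi' : i = Fin.last n
      · rw [hi', h.right_diag]; simp [diagBoundary]
      rw [h.bottom_diag i hi hi']
      simp only [Fin.ext_iff, h₀, hl] at hi hi'
      simp [diagBoundary]
      omega
    have ld : ∀ j, c.d 0 j = diagBoundary n j := by
      intro i
      by_cases hi : i = 0
      · rw [hi, h.corner]; simp [diagBoundary]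
      by_cases hi' : i = Fin.last n
      · rw [hi', h.top_diag]; simp [diagBoundary]
      rw [h.left_diag i hi hi']
      simp only [Fin.ext_iff, h₀, hl] at hi hi'
      simp [diagBoundary]
      omega
    rintro i j (rfl | rfl | rfl | rfl)
    · rw [ld, h₀, zero_add]
    · rw [h.right_diag]; simp [diagBoundary]
    · rw [bd, h₀, add_zero]
    · rw [h.top_diag]; simp [diagBoundary]
  · rintro ⟨h, ice⟩
    refine ⟨ice, h.square, fun j hj hj' => ?_, fun i hi hi' => ?_, fun j => ?_, fun i => ?_, ?_⟩
    · rw [h.diag 0 j (by simp)]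
      simp only [ne_eq, Fin.ext_iff, h₀, hl] at hj hj'
      simp [diagBoundary]
      omega
    · rw [h.diag i 0 (by simp)]
      simp only [ne_eq, Fin.ext_iff, h₀, hl] at hi hi'
      simp [diagBoundary]
      omega
    · rw [h.diag _ j (by simp)]
      simp [diagBoundary]
    · rw [h.diag i _ (by simp)]
      simp [diagBoundary]
    · rw [h.diag 0 0 (by simp)]
      simp [diagBoundary]

open scoped Classical in
/-- The refined partition functions of the 20V model in terms of modified weights in the last
column. -/
theorem Z20_add_eq_sum_boundary (hn : 0 < n) (w : Weights) {η lam μ : ℂ}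
    (hω : omega η lam μ = triWeights w.a w.b w.c w.a₂ w.b₂ w.a₃ w.b₃) :
    Z20 n η lam μ .hor w.τ + w.g * Z20 n η lam μ .diag w.τ
      = ∑ c : EdgeConfig n with Boundary (diagBoundary n) c,
          ∏ x, ∏ y, (c.vertex x y).value (w.nodeWeight n x) := by
  obtain ⟨x₀, hx₀⟩ : ∃ x : Fin n, x.val + 1 = n := ⟨⟨n - 1, by omega⟩, by simp; omega⟩
  have hprod : ∀ c : EdgeConfig n, ∏ x, ∏ y, (c.vertex x y).value (w.nodeWeight n x)
      = (∏ z : Fin n, (if c.v x₀ z.succ then w.τ else if c.d x₀.castSucc z.succ then w.g else 1))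
        * ∏ x, ∏ y, (c.vertex x y).weight20 (omega η lam μ) := by
    intro c
    rw [← prod_prod_last hx₀
      (fun x z => if c.v x z.succ then w.τ else if c.d x.castSucc z.succ then w.g else 1), hω]
    rfl
  unfold Z20 Z20At
  rw [sum_hit_mul_pow EdgeConfig.IsTwentyV (fun c y => c.HitsRight y .hor),
    sum_hit_mul_pow EdgeConfig.IsTwentyV (fun c y => c.HitsRight y .diag), Finset.mul_sum,
    ← Finset.sum_add_distrib]
  have hsub : (Finset.univ.filter fun c : EdgeConfig n => c.IsTwentyV)
      ⊆ Finset.univ.filter fun c : EdgeConfig n => Boundary (diagBoundary n) c :=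
    Finset.monotone_filter_right _ fun c _ hc => ((isTwentyV_iff c).1 hc).1
  -- The additional terms violate the ice rule at some node, where the weight vanishes.
  rw [← Finset.sum_subset hsub]
  · refine Finset.sum_congr rfl fun c hc => ?_
    have hc' := (Finset.mem_filter.1 hc).2.isDomainWall
    obtain ⟨y, s, h⟩ := hc'.exists_hitsRight hn
    rw [hprod, hc'.prod_last_column hx₀ h]
    have hit : ∀ s', (∑ y' : Fin n, if c.HitsRight y' s' then w.τ ^ (y' : ℕ) else 0)
        = if s' = s then w.τ ^ (y : ℕ) else 0 := by
      intro s'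
      rw [Finset.sum_eq_single y]
      · refine if_congr ⟨fun h' => (hc'.hitsRight_unique h h').2, fun e => e ▸ h⟩ rfl rfl
      · exact fun y' _ hy => if_neg fun h' => hy (hc'.hitsRight_unique h h').1
      · simp
    rw [hit, hit]
    have hs := h.1
    cases s with
    | hor => simp [mul_comm]
    | diag => simp; ring
    | vert => exact absurd rfl hs
  · intro c hc hc'
    rw [Finset.mem_filter] at hc hc'
    rw [hprod]
    have : ¬ ∀ x y, (c.vertex x y).Ice :=
      fun h => hc' ⟨Finset.mem_univ _, (isTwentyV_iff c).2 ⟨hc.2, h⟩⟩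
    push Not at this
    obtain ⟨x, y, h⟩ := this
    exact mul_eq_zero_of_right _ (Finset.prod_eq_zero (Finset.mem_univ x)
      (Finset.prod_eq_zero (Finset.mem_univ y) (weight20_of_not_ice h)))

end TwentyV

/-! ### The 6V generating function, with diagonals as spectators -/

section SixV

variable {n : ℕ}

namespace Weights

variable (w : Weights) (n)

/-- The weights of a node of the 6V model that is crossed by an additional diagonal. -/
def sixWeight (x : ℕ) (W S I E N O : Bool) : ℂ := if O = I then w.hvWeight n x W S E N else 0

/-- A diagonal that passes straight through with weight one lets `sum_boundary_eq` serve for the 6V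
model too. -/
theorem nodeOp_sixWeight (x y k : ℕ) :
    nodeOp (.h y) (.v x) (.d k) (w.sixWeight n x) = w.hv n x y := by
  refine LinearMap.ext fun φ => funext fun s => ?_
  rw [nodeOp_apply, hv, crossOp_apply]
  refine Finset.sum_congr rfl fun p _ => Finset.sum_congr rfl fun q _ => ?_
  rw [Finset.sum_eq_single (s (.d k))]
  · have e : update (update (update s (.h y) p) (.v x) q) (.d k) (s (.d k))
        = update (update s (.h y) p) (.v x) q := by
      rw [update_eq_self_iff]
      simp
    rw [e, sixWeight, if_pos rfl]
  · intro r _ h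
    rw [sixWeight, if_neg h, zero_mul]
  · simp

end Weights

theorem weight6_of_not_ice {a b c : ℂ} {u : Vertex} (h : ¬ u.Ice) (hI : u.inc .diag = false)
    (hO : u.out .diag = false) :
    u.weight6 a b c = 0 := by
  unfold Vertex.weight6
  unfold Vertex.Ice at h
  rw [hI, hO] at h
  generalize u.inc .hor = W, u.inc .vert = N, u.out .hor = E, u.out .vert = S at h ⊢
  cases W <;> cases N <;> cases E <;> cases S <;>
    first
    | rfl
    | exact absurd rfl h

theorem no_diag_of_boundary {c : EdgeConfig n} (hc : Boundary (fun _ => false) c)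
    (h : ∀ x y, (c.vertex x y).out .diag = (c.vertex x y).inc .diag) (i j : Fin (n + 1)) :
    c.d i j = false := by
  induction i using Fin.induction generalizing j with
  | zero => exact hc.diag _ _ (by simp)
  | succ x ih =>
    induction j using Fin.lastCases with
    | last => exact hc.diag _ _ (by simp)
    | cast y => exact (h x y).trans (ih y.succ)

open scoped Classical in
/-- The refined partition function of the 6V model in terms of modified weights in the last
column. -/
theorem Z6_eq_sum_boundary (hn : 0 < n) (w : Weights) {η lam σ : ℂ} (ha : w.a = a6 η lam)
    (hb : w.b = b6 η lam) (hc : w.c = c6 η) (hbL : w.bL = σ * b6 η lam) :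
    Z6 n η lam σ = ∑ c : EdgeConfig n with Boundary (fun _ => false) c,
      ∏ x, ∏ y, (c.vertex x y).value (w.sixWeight n x) := by
  obtain ⟨x₀, hx₀⟩ : ∃ x : Fin n, x.val + 1 = n := ⟨⟨n - 1, by omega⟩, by simp; omega⟩
  have hprod : ∀ c : EdgeConfig n, c.SquareDWBC → (∀ i j, c.d i j = false) →
      ∏ x, ∏ y, (c.vertex x y).value (w.sixWeight n x)
      = (∏ z : Fin n, (if c.v x₀ z.succ then σ else if c.d x₀.castSucc z.succ then 1 else 1))
        * ∏ x, ∏ y, (c.vertex x y).weight6 (a6 η lam) (b6 η lam) (c6 η) := by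
    intro c hsq hd
    rw [← prod_prod_last hx₀
      (fun x z => if c.v x z.succ then σ else if c.d x.castSucc z.succ then 1 else 1)]
    refine Finset.prod_congr rfl fun x _ => Finset.prod_congr rfl fun y _ => ?_
    simp only [Vertex.value, Weights.sixWeight, EdgeConfig.vertex, Weights.hvWeight, horVert,
      Vertex.weight6, ha, hb, hc, hbL, hd, if_true]
    by_cases h₁ : x.val + 1 = n
    -- The East edge is empty here, so `b` only arises from vertical passages; `bL = σ b` thus
    -- counts the vertical entries.
    · have hl : x.succ = Fin.last n := Fin.ext (by simpa using h₁)
      rw [if_pos h₁, if_pos h₁, hl, hsq.right y]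
      cases c.h x.castSucc y <;> cases c.v x y.succ <;> cases c.v x y.castSucc <;> simp [weight6]
    · rw [if_neg h₁, if_neg h₁, one_mul]
  unfold Z6 Z6At
  rw [sum_hit_mul_pow EdgeConfig.IsSixV (fun c y => ∃ s, c.HitsRight y s)]
  have hsub : (Finset.univ.filter fun c : EdgeConfig n => c.IsSixV)
      ⊆ Finset.univ.filter fun c : EdgeConfig n => Boundary (fun _ => false) c :=
    Finset.monotone_filter_right _ fun c _ hc => ⟨hc.square, fun i j _ => hc.no_diag i j⟩
  rw [← Finset.sum_subset hsub]
  · refine Finset.sum_congr rfl fun c hc => ?_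
    have h6 := (Finset.mem_filter.1 hc).2
    have hc' := h6.isDomainWall
    obtain ⟨y, s, h⟩ := hc'.exists_hitsRight hn
    rw [hprod c h6.square h6.no_diag, hc'.prod_last_column hx₀ h, Finset.sum_eq_single y]
    · rw [if_pos ⟨s, h⟩, ite_self, mul_one, mul_comm]
    · exact fun y' _ hy => if_neg fun ⟨_, h'⟩ => hy (hc'.hitsRight_unique h h').1
    · simp
  · intro c hB h6
    rw [Finset.mem_filter] at hB h6
    by_cases hd : ∀ x y, (c.vertex x y).out .diag = (c.vertex x y).inc .diag
    · have hd' := no_diag_of_boundary hB.2 hd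
      rw [hprod c hB.2.square hd']
      have : ¬ ∀ x y, (c.vertex x y).Ice := fun h => h6 ⟨Finset.mem_univ _, h, hB.2.square, hd'⟩
      push Not at this
      obtain ⟨x, y, h⟩ := this
      exact mul_eq_zero_of_right _ (Finset.prod_eq_zero (Finset.mem_univ x)
        (Finset.prod_eq_zero (Finset.mem_univ y) (weight6_of_not_ice h (hd' _ _) (hd' _ _))))
    · push Not at hd
      obtain ⟨x, y, h⟩ := hd
      refine Finset.prod_eq_zero (Finset.mem_univ x) (Finset.prod_eq_zero (Finset.mem_univ y) ?_)
      exact if_neg h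

end SixV

/-! ### Independence of the 6V operators from the diagonals -/

section Spectators

/-- Flip the occupation of the diagonals `k` with `δ k = true`. -/
def flipDiag (δ : ℕ → Bool) (s : State) : State
  | .h y => s (.h y)
  | .v x => s (.v x)
  | .d k => xor (s (.d k)) (δ k)

/-- The operators that do not act on the diagonals. -/
def IgnoresDiag (δ : ℕ → Bool) (T : Module.End ℂ (State → ℂ)) : Prop :=
  ∀ φ : State → ℂ, T (fun s => φ (flipDiag δ s)) = fun s => T φ (flipDiag δ s)

variable {δ : ℕ → Bool}

theorem IgnoresDiag.rangeProd {f : ℕ → Module.End ℂ (State → ℂ)} {m : ℕ}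
    (h : ∀ i < m, IgnoresDiag δ (f i)) : IgnoresDiag δ (rangeProd f m) :=
  rangeProd_induction (fun _ => rfl)
    (fun S T hS hT φ => by rw [Module.End.mul_apply, hT, hS]; rfl) h

theorem Weights.ignoresDiag_hv (w : Weights) (n x y : ℕ) : IgnoresDiag δ (w.hv n x y) := by
  intro φ
  funext s
  rw [Weights.hv, crossOp_apply, crossOp_apply]
  refine Finset.sum_congr rfl fun p _ => Finset.sum_congr rfl fun q _ => ?_
  have e : flipDiag δ (update (update s (.h y) p) (.v x) q)
      = update (update (flipDiag δ s) (.h y) p) (.v x) q := by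
    funext l
    cases l <;> simp [flipDiag, update_apply]
  rw [e]
  rfl

theorem Weights.ignoresDiag_lower6 (w : Weights) (n m : ℕ) : IgnoresDiag δ (w.lower6 n m) :=
  .rangeProd fun _ _ => .rangeProd fun _ _ => w.ignoresDiag_hv _ _ _

theorem Weights.ignoresDiag_upper6 (w : Weights) (n o p : ℕ) :
    IgnoresDiag δ (w.upper6 n o p) := by
  induction p generalizing o with
  | zero => exact fun _ => rfl
  | succ p ih =>
    intro φ
    rw [upper6_succ, Module.End.mul_apply, ih]
    exact IgnoresDiag.rangeProd (fun _ _ => w.ignoresDiag_hv _ _ _) _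

theorem finalVec_flipDiag (n : ℕ) (s : State) :
    finalVec n (fun _ => false) (flipDiag δ s) = finalVec n δ s := by
  unfold finalVec
  refine if_congr ?_ rfl rfl
  simp [flipDiag]

theorem flipDiag_initialState : flipDiag δ (initialState δ) = initialState fun _ => false := by
  funext l
  cases l <;> simp [flipDiag, initialState]

/-- The occupation of the diagonals does not matter in the 6V model. -/
theorem Weights.lower6_upper6_initialState (w : Weights) (n : ℕ) (δ : ℕ → Bool) :
    w.lower6 n n (w.upper6 n 0 n (finalVec n fun _ => false)) (initialState fun _ => false)
      = w.lower6 n n (w.upper6 n 0 n (finalVec n δ)) (initialState δ) := by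
  have e : finalVec n δ = fun s => finalVec n (fun _ => false) (flipDiag δ s) :=
    funext fun s => (finalVec_flipDiag n s).symm
  rw [e, w.ignoresDiag_upper6 n 0 n, w.ignoresDiag_lower6 n n, ← flipDiag_initialState (δ := δ)]

end Spectators

/-! ### Combination, and trigonometric parametrization -/

/-- The relation between the refined partition functions, for all compatible weights. -/
theorem Z20_add_eq_Z6 {n : ℕ} (hn : 0 < n) {w : Weights} (hw : w.Compatible) {η lam μ σ : ℂ}
    (hω : omega η lam μ = triWeights w.a w.b w.c w.a₂ w.b₂ w.a₃ w.b₃) (ha : w.a = a6 η lam)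
    (hb : w.b = b6 η lam) (hc : w.c = c6 η) (hbL : w.bL = σ * b6 η lam) :
    Z20 n η lam μ .hor w.τ + w.g * Z20 n η lam μ .diag w.τ
      = (w.a₂ * w.a₃) ^ (n ^ 2) * Z6 n η lam σ := by
  rw [Z20_add_eq_sum_boundary hn w hω, Z6_eq_sum_boundary hn w ha hb hc hbL, sum_boundary_eq,
    sum_boundary_eq]
  simp only [Weights.nodeOp_sixWeight]
  refine (Weights.lower20_upper20_apply hw (φ := finalVec n (diagBoundary n))
    (s := initialState (diagBoundary n)) (fun _ => rfl) (fun _ => rfl) ?_ ?_ ?_ ?_ ?_ ?_).trans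
    (congrArg _ (w.lower6_upper6_initialState n _).symm)
  · intro k hk hk'
    simp [initialState, diagBoundary, hk, hk']
  · intro k hk _
    simp [initialState, diagBoundary, hk]
  · intro y hy s hs
    exact if_neg fun h => by simp [h.1 y hy] at hs
  · intro x hx s hs
    exact if_neg fun h => by simp [h.2.1 x hx] at hs
  · intro k hk hk' s hs
    refine if_neg fun h => ?_
    simp [h.2.2 k (by omega), diagBoundary, hk, hk'] at hs
  · intro k hk hk' s hs
    refine if_neg fun h => ?_
    simp [h.2.2 k (by omega), diagBoundary] at hs
    omega

section Angles

open Complex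

/-- With `A`, `B` the arguments of `b₂`, `b₃` in either order and `e = 2η`, this is `hor` or `vert`;
the next identity likewise gives `prod`. -/
theorem sin_add_mul_sin_add_left (A B e : ℂ) :
    sin (A + B) * sin (A + e) = sin (A + B + e) * sin A + sin e * sin B := by
  simp only [sin_add, cos_add]
  linear_combination (sin e * sin B) * sin_sq_add_cos_sq A

theorem sin_add_mul_sin_add_right (A B e : ℂ) :
    sin (A + e) * sin (B + e) = sin A * sin B + sin e * sin (A + B + e) := by
  simp only [sin_add, cos_add]
  linear_combination (sin A * sin B) * sin_sq_add_cos_sq e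

theorem sin_sub_mul_sin_add (A e : ℂ) :
    sin (A - e) * sin (A + e) = sin A ^ 2 - sin e ^ 2 := by
  simp only [sin_add, sin_sub]
  linear_combination sin A ^ 2 * sin_sq_add_cos_sq e - sin e ^ 2 * sin_sq_add_cos_sq A

variable (η lam μ : ℂ)

theorem sin_relation_hor : sin (lam - η) * sin ((lam + 3 * η - μ) / 2)
    = sin (lam + η) * sin ((lam - η - μ) / 2) + sin (2 * η) * sin ((lam - η + μ) / 2) := by
  convert sin_add_mul_sin_add_left ((lam - η - μ) / 2) ((lam - η + μ) / 2) (2 * η) using 3 <;> ring_nf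

theorem sin_relation_vert : sin (lam - η) * sin ((lam + 3 * η + μ) / 2)
    = sin (lam + η) * sin ((lam - η + μ) / 2) + sin (2 * η) * sin ((lam - η - μ) / 2) := by
  convert sin_add_mul_sin_add_left ((lam - η + μ) / 2) ((lam - η - μ) / 2) (2 * η) using 3 <;> ring_nf

theorem sin_relation_prod : sin ((lam + 3 * η - μ) / 2) * sin ((lam + 3 * η + μ) / 2)
    = sin ((lam - η - μ) / 2) * sin ((lam - η + μ) / 2) + sin (2 * η) * sin (lam + η) := by
  convert sin_add_mul_sin_add_right ((lam - η - μ) / 2) ((lam - η + μ) / 2) (2 * η) using 3 <;> ring_nf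

/-- Eliminating `b₃L` from `horL` and `prodL` produces `b₂ ^ 2 - c ^ 2`. This identity splits off a
factor `a₂`, which cancels and leaves `den`. -/
theorem sin_relation_den : sin ((lam - 5 * η - μ) / 2) * sin ((lam + 3 * η - μ) / 2)
    = sin ((lam - η - μ) / 2) ^ 2 - sin (2 * η) ^ 2 := by
  convert sin_sub_mul_sin_add ((lam - η - μ) / 2) (2 * η) using 3 <;> ring_nf

theorem exp_sub_exp (x y : ℂ) :
    exp (I * x) - exp (I * y) = 2 * I * exp (I * ((x + y) / 2)) * sin ((x - y) / 2) := by
  have hx : exp (I * x) = exp (I * ((x + y) / 2)) * exp (((x - y) / 2) * I) := by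
    rw [← exp_add]; ring_nf
  have hy : exp (I * y) = exp (I * ((x + y) / 2)) * exp (-((x - y) / 2) * I) := by
    rw [← exp_add]; ring_nf
  rw [hx, hy, sin]
  linear_combination exp (I * ((x + y) / 2)) * (exp (((x - y) / 2) * I)
    - exp (-((x - y) / 2) * I)) * I_sq

theorem a2_eq : a2 η lam μ
    = exp (I * ((lam + η + μ) / 2)) / tCbrt μ * sin ((lam + 3 * η - μ) / 2) := by
  have e : qPar η * zPar η lam - (qPar η)⁻¹ * tPar μ
      = exp (I * (lam + 2 * η)) - exp (I * (μ - η)) := by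
    simp only [qPar, zPar, tPar, ← exp_neg, ← exp_add]
    ring_nf
  have ht : tCbrt μ ≠ 0 := exp_ne_zero _
  have hI : I ≠ 0 := I_ne_zero
  rw [a2, nuPar, e, exp_sub_exp]
  rw [show (lam + 2 * η + (μ - η)) / 2 = (lam + η + μ) / 2 by ring,
    show (lam + 2 * η - (μ - η)) / 2 = (lam + 3 * η - μ) / 2 by ring]
  field_simp

theorem a3_eq : a3 η lam μ
    = exp (I * ((μ - lam - η) / 2)) / tCbrt μ * sin ((lam + 3 * η + μ) / 2) := by
  have e : qPar η * tPar μ - (qPar η)⁻¹ * wPar η lam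
      = exp (I * (μ + η)) - exp (I * (-lam - 2 * η)) := by
    simp only [qPar, wPar, tPar, ← exp_neg, ← exp_add]
    ring_nf
  have ht : tCbrt μ ≠ 0 := exp_ne_zero _
  have hI : I ≠ 0 := I_ne_zero
  rw [a3, nuPar, e, exp_sub_exp]
  rw [show (μ + η + (-lam - 2 * η)) / 2 = (μ - lam - η) / 2 by ring,
    show (μ + η - (-lam - 2 * η)) / 2 = (lam + 3 * η + μ) / 2 by ring]
  field_simp

/-- The phases of `a2` and `a3` multiply to `exp (i μ)`, the cube of `tCbrt μ`, which the three
factors `tCbrt μ` in the denominators cancel. -/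
theorem a2_mul_a3_div : a2 η lam μ * a3 η lam μ / tCbrt μ
    = sin ((lam + 3 * η - μ) / 2) * sin ((lam + 3 * η + μ) / 2) := by
  have ht : tCbrt μ ≠ 0 := exp_ne_zero _
  have e : exp (I * ((lam + η + μ) / 2)) * exp (I * ((μ - lam - η) / 2)) = tCbrt μ ^ 3 := by
    rw [tCbrt, ← exp_nat_mul, ← exp_add]
    congr 1
    push_cast
    ring
  rw [a2_eq, a3_eq, div_eq_iff ht]
  generalize exp (I * ((lam + η + μ) / 2)) = x at *
  generalize exp (I * ((μ - lam - η) / 2)) = y at *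
  generalize sin ((lam + 3 * η - μ) / 2) = u
  generalize sin ((lam + 3 * η + μ) / 2) = v
  field_simp
  linear_combination u * v * e

/-- The weights in the statement of the main theorem. -/
noncomputable def sinWeights (σ : ℂ) : Weights where
  a := a6 η lam
  b := b6 η lam
  c := c6 η
  a₂ := sin ((lam + 3 * η - μ) / 2)
  b₂ := sin ((lam - η - μ) / 2)
  a₃ := sin ((lam + 3 * η + μ) / 2)
  b₃ := sin ((lam - η + μ) / 2)
  bL := σ * b6 η lam
  b₃L := sin ((lam + 3 * η + μ) / 2) * (σ * sin (lam - η) * sin ((lam + 3 * η - μ) / 2)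
    - sin (lam + η) * sin ((lam - η - μ) / 2)) / den η lam μ σ
  c₃L := sin ((lam + 3 * η + μ) / 2) * sin (2 * η) ^ 2 / den η lam μ σ
  τ := tau η lam μ σ
  g := gFun η lam μ σ

/-- For `bL = σ b`, the relations `horL` and `prodL` are linear in `b₃L` and `c₃L`, and `sinWeights`
contains their solution. The formulas for `τ` and `g` come from `tau_eq` and `g_eq`; `hsin` is the
division by `b₃` in `τ`. -/
theorem compatible_sinWeights {σ : ℂ} (hden : den η lam μ σ ≠ 0)
    (hsin : sin ((lam - η + μ) / 2) ≠ 0) : (sinWeights η lam μ σ).Compatible where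
  hor := sin_relation_hor η lam μ
  prod := sin_relation_prod η lam μ
  vert := sin_relation_vert η lam μ
  horL := by
    simp only [sinWeights, a6, b6, c6]
    field_simp
    ring
  prodL := by
    simp only [sinWeights, a6, b6, c6]
    have h := sin_relation_den η lam μ
    have hd : den η lam μ σ = σ * sin (lam - η) * sin ((lam - η - μ) / 2)
      - sin (lam + η) * sin ((lam - 5 * η - μ) / 2) := rfl
    generalize sin ((lam + 3 * η + μ) / 2) = v
    generalize sin ((lam + 3 * η - μ) / 2) = u at h ⊢
    field_simp
    rw [hd]
    linear_combination -sin (2 * η) * v * sin (lam + η) * h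
  tau_eq := by
    simp only [sinWeights, b6, tau]
    field_simp
  g_eq := by
    simp only [sinWeights, b6, c6, gFun]
    field_simp

end Angles

end TwentyVertex

theorem theorem3p1 (n : ℕ) (η lam μ σ : ℂ)
    (hden : TwentyVertex.den η lam μ σ ≠ 0)
    (hsin : Complex.sin ((lam - η + μ) / 2) ≠ 0) :
    TwentyVertex.Z20 n η lam μ .hor (TwentyVertex.tau η lam μ σ)
        + TwentyVertex.gFun η lam μ σ
          * TwentyVertex.Z20 n η lam μ .diag (TwentyVertex.tau η lam μ σ)
      = (TwentyVertex.a2 η lam μ * TwentyVertex.a3 η lam μ / TwentyVertex.tCbrt μ) ^ (n ^ 2)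
          * TwentyVertex.Z6 n η lam σ := by
  rcases Nat.eq_zero_or_pos n with rfl | hn
  · simp [TwentyVertex.Z20, TwentyVertex.Z6]
  · rw [TwentyVertex.a2_mul_a3_div]
    exact TwentyVertex.Z20_add_eq_Z6 hn (TwentyVertex.compatible_sinWeights η lam μ hden hsin)
      rfl rfl rfl rfl rfl
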